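/- All manifolds, maps and tensor fields are $C^\infty$; a (pseudo-)Riemannian metric is a symmetric non-degenerate $2$-covariant tensor field. Let $N$ be an $n$-dimensional manifold and let $\omega$ be a $2$-form on $N$ of constant rank $2r\le n$ (so $(N,\omega)$ is an almost presymplectic manifold), with annihilator $K=\operatorname{ann}\omega=\{v\in TN:\omega(v,\cdot)=0\}$. Assume that 1) $K$ is tangent to a foliation $\mathcal K$ of $N$; 2) locally, $K$ is spanned by infinitesimal automorphisms of $\omega$, that is, every point has an open neighbourhood $U$ with finitely many vector fields $X_1,\dots,X_m$ on $U$ that span $K|_U$ and satisfy $\mathfrak L_{X_i}\omega=0$; 3) there is a surjective submersion $p:N\to Q$ with connected fibres onto a manifold $Q$ of dimension $2r$ (in particular $p$ may be a locally trivial fibration with connected fibres), and $p$ is constant on the leaves of $\mathcal K$. Then there is a unique $2$-form $\varpi$ on $Q$ with $\omega=p^*\varpi$, and $\varpi$ is non-degenerate. Furthermore, let $g$ be a (pseudo-)Riemannian metric on $N$ whose restriction to $K$ is non-degenerate, put $K'=K^{\perp_g}$ (so $TN=K\oplus K'$), and assume that there is a (pseudo-)Riemannian metric $\lambda$ on $Q$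 with $g_{K'}=p^*\lambda$, that is, $g(v,w)=\lambda(dp\,v,dp\,w)$ for all $x\in N$ and $v,w\in K'_x$. Then the Levi-Civita connection $\nabla^g$ of $g$ projects to the Levi-Civita connection $\nabla^\lambda$ of $\lambda$, in the following sense. Let $U\subseteq N$ be open. A vector field $X$ on $U$ is called projectable, with projection the vector field $[X]$ on $p(U)$, if $dp(X_x)=[X]_{p(x)}$ for all $x\in U$. If $X,Y$ are projectable vector fields on $U$ with values in $K'$, then $\mathrm{pr}_{K'}\nabla^g_XY$ is projectable, with projection $\nabla^\lambda_{[X]}[Y]$, where $\mathrm{pr}_{K'}$ is the projection of $TN=K\oplus K'$ onto $K'$. -/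

import Mathlib

open Set
open scoped Manifold ContDiff Topology Bundle

namespace Presymplectic

noncomputable section

/-! Smooth manifolds of dimension `n` are modelled on `EuclideanSpace ℝ (Fin n)`, without boundary.
Vector fields are sections `X : Π x, TangentSpace (𝓡 n) x` of the tangent bundle. -/

section Tensors

variable (n : ℕ) (M : Type*) [TopologicalSpace M] [ChartedSpace (EuclideanSpace ℝ (Fin n)) M]
  [IsManifold (𝓡 n) ∞ M]

/-- A smooth differential `2`-form on an `n`-dimensional manifold: a smooth section of the bundle
of bilinear forms on the tangent spaces, with alternating values. -/
@[ext]
structure TwoForm where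
  /-- The bilinear form at each point. -/
  form (x : M) : TangentSpace (𝓡 n) x →L[ℝ] TangentSpace (𝓡 n) x →L[ℝ] ℝ
  alt (x : M) (v : TangentSpace (𝓡 n) x) : form x v v = 0
  smooth : ContMDiff (𝓡 n)
    ((𝓡 n).prod 𝓘(ℝ, EuclideanSpace ℝ (Fin n) →L[ℝ] EuclideanSpace ℝ (Fin n) →L[ℝ] ℝ)) ∞
    (fun x ↦ Bundle.TotalSpace.mk'
      (EuclideanSpace ℝ (Fin n) →L[ℝ] EuclideanSpace ℝ (Fin n) →L[ℝ] ℝ) x (form x))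

/-- A (pseudo-)Riemannian metric on an `n`-dimensional manifold: a smooth, symmetric,
non-degenerate `2`-covariant tensor field (of any signature). -/
@[ext]
structure PseudoMetric where
  /-- The bilinear form at each point. -/
  form (x : M) : TangentSpace (𝓡 n) x →L[ℝ] TangentSpace (𝓡 n) x →L[ℝ] ℝ
  symm (x : M) (v w : TangentSpace (𝓡 n) x) : form x v w = form x w v
  nondegenerate (x : M) (v : TangentSpace (𝓡 n) x) (hv : ∀ w, form x v w = 0) : v = 0
  smooth : ContMDiff (𝓡 n)
    ((𝓡 n).prod 𝓘(ℝ, EuclideanSpace ℝ (Fin n) →L[ℝ] EuclideanSpace ℝ (Fin n) →L[ℝ] ℝ)) ∞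
    (fun x ↦ Bundle.TotalSpace.mk'
      (EuclideanSpace ℝ (Fin n) →L[ℝ] EuclideanSpace ℝ (Fin n) →L[ℝ] ℝ) x (form x))

end Tensors

section Manifolds

variable {n : ℕ} {M : Type*} [TopologicalSpace M] [ChartedSpace (EuclideanSpace ℝ (Fin n)) M]
  [IsManifold (𝓡 n) ∞ M]

/-- The vector field `X` is smooth on the set `U`. -/
def SmoothFieldOn (U : Set M) (X : Π x : M, TangentSpace (𝓡 n) x) : Prop :=
  ContMDiffOn (𝓡 n) (𝓡 n).tangent ∞ (fun x ↦ (⟨x, X x⟩ : TangentBundle (𝓡 n) M)) U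

/-- The vector field `X`, seen as a map to the tangent bundle, is differentiable at `x`. -/
def DifferentiableFieldAt (X : Π x : M, TangentSpace (𝓡 n) x) (x : M) : Prop :=
  MDifferentiableAt (𝓡 n) (𝓡 n).tangent (fun y ↦ (⟨y, X y⟩ : TangentBundle (𝓡 n) M)) x

namespace TwoForm

/-- The annihilator (kernel) `K = ann Ω`: `K_x = {v | Ω_x(v, w) = 0 for all w}`. -/
def ann (Ω : TwoForm n M) (x : M) : Submodule ℝ (TangentSpace (𝓡 n) x) :=
  LinearMap.ker (Ω.form x).toLinearMap

/-- `Ω` has constant rank `k`: each map `v ↦ Ω_x(v, ·)` has rank `k`. A pair `(M, Ω)` with `Ω` a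
`2`-form of constant rank is an almost presymplectic manifold. -/
def HasConstantRank (Ω : TwoForm n M) (k : ℕ) : Prop :=
  ∀ x, Module.finrank ℝ (LinearMap.range (Ω.form x).toLinearMap) = k

/-- `Ω` is non-degenerate at every point. -/
def Nondegenerate (Ω : TwoForm n M) : Prop :=
  ∀ x, ∀ v : TangentSpace (𝓡 n) x, (∀ w, Ω.form x v w = 0) → v = 0

/-- The Lie derivative of a `2`-form, evaluated on the vector fields `Y`, `Z`:
`(𝓛_X Ω)(Y, Z) = X(Ω(Y, Z)) - Ω([X, Y], Z) - Ω(Y, [X, Z])`. -/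
def lieDerivative (Ω : TwoForm n M) (X Y Z : Π x : M, TangentSpace (𝓡 n) x) (x : M) : ℝ :=
  mvfderiv (𝓡 n) (fun y ↦ Ω.form y (Y y) (Z y)) x (X x)
    - Ω.form x (VectorField.mlieBracket (𝓡 n) X Y x) (Z x)
    - Ω.form x (Y x) (VectorField.mlieBracket (𝓡 n) X Z x)

/-- On the open set `U`, `X` is a (smooth) infinitesimal automorphism of `Ω`: `𝓛_X Ω = 0`. -/
def IsInfinitesimalAutomorphismOn (Ω : TwoForm n M) (U : Set M)
    (X : Π x : M, TangentSpace (𝓡 n) x) : Prop :=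
  SmoothFieldOn U X ∧
    ∀ Y Z : Π x : M, TangentSpace (𝓡 n) x, SmoothFieldOn U Y → SmoothFieldOn U Z →
      ∀ x ∈ U, Ω.lieDerivative X Y Z x = 0

/-- The distribution `K` is locally spanned by infinitesimal automorphisms of `Ω`. -/
def LocallySpannedByAutomorphisms (Ω : TwoForm n M)
    (K : Π x : M, Submodule ℝ (TangentSpace (𝓡 n) x)) : Prop :=
  ∀ x, ∃ U : Set M, IsOpen U ∧ x ∈ U ∧
    ∃ (m : ℕ) (X : Fin m → Π y : M, TangentSpace (𝓡 n) y),
      (∀ i, Ω.IsInfinitesimalAutomorphismOn U (X i)) ∧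
      ∀ y ∈ U, K y = Submodule.span ℝ (Set.range fun i ↦ X i y)

end TwoForm

/-- The distribution `K` is tangent to a foliation of codimension `c`: around every point there is
a smooth chart `(x¹, …, xⁿ)` in which `K` is given by `dx¹ = ⋯ = dxᶜ = 0`. -/
def IsTangentToFoliation (c : ℕ) (K : Π x : M, Submodule ℝ (TangentSpace (𝓡 n) x)) : Prop :=
  ∀ x, ∃ φ ∈ IsManifold.maximalAtlas (𝓡 n) ∞ M, x ∈ φ.source ∧
    ∀ y ∈ φ.source, ∀ v : TangentSpace (𝓡 n) y,
      v ∈ K y ↔ ∀ i : Fin n, (i : ℕ) < c →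
        (show EuclideanSpace ℝ (Fin n) from mfderiv (𝓡 n) (𝓡 n) φ y v) i = 0

/-- `x` and `y` are joined by a smooth curve tangent to `K`. -/
def JoinedByTangentCurve (K : Π x : M, Submodule ℝ (TangentSpace (𝓡 n) x)) (x y : M) : Prop :=
  ∃ γ : ℝ → M, ContMDiff 𝓘(ℝ, ℝ) (𝓡 n) ∞ γ ∧ γ 0 = x ∧ γ 1 = y ∧
    ∀ t : ℝ, mfderiv 𝓘(ℝ, ℝ) (𝓡 n) γ t (1 : ℝ) ∈ K (γ t)

/-- The leaf through `x` of the foliation with tangent distribution `K`: the points that can be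
reached from `x` along finitely many smooth curves tangent to `K`. -/
def leaf (K : Π x : M, Submodule ℝ (TangentSpace (𝓡 n) x)) (x : M) : Set M :=
  {y | Relation.EqvGen (JoinedByTangentCurve K) x y}

namespace PseudoMetric

/-- The bilinear form `g_x` on the tangent space at `x`. -/
def bilin (g : PseudoMetric n M) (x : M) : LinearMap.BilinForm ℝ (TangentSpace (𝓡 n) x) :=
  LinearMap.mk₂ ℝ (fun v w ↦ g.form x v w) (by simp) (by simp) (by simp) (by simp)

/-- The restriction of `g` to the distribution `K` is non-degenerate. -/
def NondegenerateOn (g : PseudoMetric n M)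
    (K : Π x : M, Submodule ℝ (TangentSpace (𝓡 n) x)) : Prop :=
  ∀ x, ∀ v ∈ K x, (∀ w ∈ K x, g.form x v w = 0) → v = 0

/-- The `g`-orthogonal distribution `K' = K^⊥`: `K'_x = {w | g_x(v, w) = 0 for all v ∈ K_x}`. -/
def perp (g : PseudoMetric n M) (K : Π x : M, Submodule ℝ (TangentSpace (𝓡 n) x)) (x : M) :
    Submodule ℝ (TangentSpace (𝓡 n) x) :=
  (g.bilin x).orthogonal (K x)

theorem mem_perp (g : PseudoMetric n M) (K : Π x : M, Submodule ℝ (TangentSpace (𝓡 n) x)) (x : M)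
    (w : TangentSpace (𝓡 n) x) : w ∈ g.perp K x ↔ ∀ v ∈ K x, g.form x v w = 0 :=
  Iff.rfl

theorem isCompl_perp (g : PseudoMetric n M) (K : Π x : M, Submodule ℝ (TangentSpace (𝓡 n) x))
    (hK : g.NondegenerateOn K) (x : M) : IsCompl (g.perp K x) (K x) := by
  have : FiniteDimensional ℝ (TangentSpace (𝓡 n) x) :=
    inferInstanceAs (FiniteDimensional ℝ (EuclideanSpace ℝ (Fin n)))
  have hrefl : (g.bilin x).IsRefl := fun v w h ↦ (g.symm x w v).trans h
  refine ((LinearMap.BilinForm.isCompl_orthogonal_iff_disjoint hrefl).2 ?_).symm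
  rw [Submodule.disjoint_def]
  intro v hv hv'
  exact hK x v hv fun w hw ↦ (g.symm x v w).trans (hv' w hw)

/-- The projection `pr_{K'} : T_x M → T_x M` onto `K' = K^⊥` along `K`. -/
def prPerp (g : PseudoMetric n M) (K : Π x : M, Submodule ℝ (TangentSpace (𝓡 n) x))
    (hK : g.NondegenerateOn K) (x : M) : TangentSpace (𝓡 n) x →ₗ[ℝ] TangentSpace (𝓡 n) x :=
  (g.perp K x).projection (K x) (g.isCompl_perp K hK x)

/-- `∇` is the Levi-Civita connection of `g`: it is smooth, torsion-free, and metric,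
`X(g(Y, Z)) = g(∇_X Y, Z) + g(Y, ∇_X Z)`. The argument order is `∇ Y x (X x) = (∇_X Y)(x)`. -/
structure IsLeviCivita (g : PseudoMetric n M)
    (cov : CovariantDerivative (𝓡 n) (EuclideanSpace ℝ (Fin n))
      (TangentSpace (𝓡 n) : M → Type _)) : Prop where
  smooth : CovariantDerivative.ContMDiffCovariantDerivative cov ∞
  torsion_free :
    have : IsManifold (𝓡 n) 2 M := IsManifold.of_le (n := ∞) (by norm_cast)
    cov.torsion = 0
  metric : ∀ (Y Z : Π x : M, TangentSpace (𝓡 n) x) (x : M) (v : TangentSpace (𝓡 n) x),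
    DifferentiableFieldAt Y x → DifferentiableFieldAt Z x →
      mvfderiv (𝓡 n) (fun y ↦ g.form y (Y y) (Z y)) x v
        = g.form x (cov Y x v) (Z x) + g.form x (Y x) (cov Z x v)

end PseudoMetric

end Manifolds

section Projections

variable {n k : ℕ}
  {N : Type*} [TopologicalSpace N] [ChartedSpace (EuclideanSpace ℝ (Fin n)) N]
  [IsManifold (𝓡 n) ∞ N]
  {Q : Type*} [TopologicalSpace Q] [ChartedSpace (EuclideanSpace ℝ (Fin k)) Q]
  [IsManifold (𝓡 k) ∞ Q]

/-- `Ω = p^* Ψ`. -/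
def IsPullback (p : N → Q) (Ω : TwoForm n N) (Ψ : TwoForm k Q) : Prop :=
  ∀ x, ∀ v w : TangentSpace (𝓡 n) x,
    Ω.form x v w
      = Ψ.form (p x) (mfderiv (𝓡 n) (𝓡 k) p x v) (mfderiv (𝓡 n) (𝓡 k) p x w)

/-- The restriction of `g` to the distribution `D` is the pullback of `l`:
`g_x(v, w) = l_{p x}(dp v, dp w)` for `v, w ∈ D_x`. -/
def RestrictionIsPullback (p : N → Q) (D : Π x : N, Submodule ℝ (TangentSpace (𝓡 n) x))
    (g : PseudoMetric n N) (l : PseudoMetric k Q) : Prop :=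
  ∀ x, ∀ v ∈ D x, ∀ w ∈ D x,
    g.form x v w
      = l.form (p x) (mfderiv (𝓡 n) (𝓡 k) p x v) (mfderiv (𝓡 n) (𝓡 k) p x w)

/-- On the open set `U`, `X` is a projectable (foliated) vector field that projects to the vector
field `X'` on `p(U)`: both are smooth and `dp(X_x) = X'_{p x}`. -/
def ProjectsToOn (p : N → Q) (U : Set N) (X : Π x : N, TangentSpace (𝓡 n) x)
    (X' : Π q : Q, TangentSpace (𝓡 k) q) : Prop :=
  SmoothFieldOn U X ∧ SmoothFieldOn (p '' U) X' ∧
    ∀ x ∈ U, mfderiv (𝓡 n) (𝓡 k) p x (X x) = X' (p x)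

/-- The connection `cov` on `N` projects to the connection `cov'` on `Q`, where `K` is the
distribution along which one projects and `K' = K^⊥` is its `g`-orthogonal: for all projectable
vector fields `X, Y ∈ Γ K'` (on any open set `U`, in particular on `N`) with projections `X', Y'`,
the vector field `pr_{K'} ∇_X Y` is projectable, and projects to `∇'_{X'} Y'`. -/
def ConnectionProjects (p : N → Q) (g : PseudoMetric n N)
    (K : Π x : N, Submodule ℝ (TangentSpace (𝓡 n) x)) (hK : g.NondegenerateOn K)
    (cov : CovariantDerivative (𝓡 n) (EuclideanSpace ℝ (Fin n))
      (TangentSpace (𝓡 n) : N → Type _))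
    (cov' : CovariantDerivative (𝓡 k) (EuclideanSpace ℝ (Fin k))
      (TangentSpace (𝓡 k) : Q → Type _)) : Prop :=
  ∀ U : Set N, IsOpen U →
    ∀ (X Y : Π x : N, TangentSpace (𝓡 n) x) (X' Y' : Π q : Q, TangentSpace (𝓡 k) q),
      (∀ x ∈ U, X x ∈ g.perp K x) → (∀ x ∈ U, Y x ∈ g.perp K x) →
      ProjectsToOn p U X X' → ProjectsToOn p U Y Y' →
      ProjectsToOn p U (fun x ↦ g.prPerp K hK x (cov Y x (X x))) (fun q ↦ cov' Y' q (X' q))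

end Projections

end

end Presymplectic

/-! The first point is that `K = ann Ω` is exactly the vertical distribution `ker dp`. Since `p` is
constant on leaves, `dp` kills `K`; since `Ω` has rank `2r = dim Q` and `dp` is onto, both spaces
have dimension `n - 2r` (`TwoForm.mem_ann_iff_mfderiv_eq_zero`).

Hence each `Ω_x` descends to a bilinear form `B_x` on `T_{p x} Q`, and the question is whether `B_x`
depends only on `p x`. Given tangent vectors `v`, `w` of `Q`, extend them to fields `V'`, `W'` and
lift these to fields `V`, `W` on `N`; on the fibre, `B_y(v, w) = Ω_y(V, W)`. If `X` is a vertical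
infinitesimal automorphism, then `[X, V]` projects to `[0, V'] = 0`, so it lies in `K`, and likewise
`[X, W]`. The bracket terms of `(𝓛_X Ω)(V, W) = 0` therefore vanish and `X(Ω(V, W)) = 0`. Such `X`
span `K`, so `Ω(V, W)` is locally constant on the fibre, hence constant because the fibre is
connected (`TwoForm.eventually_apply_eq_of_related`, `TwoForm.fibrewise_form_eq`). Smoothness of the
descended form is checked along local sections of `p`, and its non-degeneracy is the equality `ann Ω
= ker dp`.

For the connections, test against a horizontal projectable field `Z`. Every term of the Koszul
formula for `X, Y, Z` equals the corresponding term for the projected fields: the functions `g(Y,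
Z)` are pulled back from `Q`, and `g([X, Y], Z)` sees only the horizontal part of `[X, Y]`, which is
determined by `dp [X, Y] = [X', Y']`. Non-degeneracy of the metric on `Q` then gives `dp (∇_X Y) =
∇'_{X'} Y'` (`mfderiv_cov_eq`), and `pr_{K'}` does not change `dp`. -/

set_option linter.unusedSectionVars false

namespace Presymplectic

noncomputable section

open Bundle FiberBundle Trivialization ContinuousLinearMap

/-! ### Smoothness of tensor fields and vector fields through contractions -/

section Sections

variable {n : ℕ} {M : Type*} [TopologicalSpace M] [ChartedSpace (EuclideanSpace ℝ (Fin n)) M]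

/-- A map into a space of continuous linear maps on a finite-dimensional space is `C^k` as soon as
its evaluations are. -/
theorem contMDiffAt_clm_of_forall_apply {k : WithTop ℕ∞} {E F : Type*} [NormedAddCommGroup E]
    [NormedSpace ℝ E] [FiniteDimensional ℝ E] [NormedAddCommGroup F] [NormedSpace ℝ F]
    {f : M → E →L[ℝ] F} {x : M}
    (h : ∀ u, ContMDiffAt (𝓡 n) 𝓘(ℝ, F) k (fun y ↦ f y u) x) :
    ContMDiffAt (𝓡 n) 𝓘(ℝ, E →L[ℝ] F) k f x := by
  let b := Module.finBasis ℝ E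
  have key : f = fun y ↦ ∑ i, ContinuousLinearMap.smulRightL ℝ E F
      (LinearMap.toContinuousLinearMap (b.coord i)) (f y (b i)) := by
    funext y
    refine ContinuousLinearMap.ext fun u ↦ ?_
    conv_lhs => rw [← b.sum_repr u, map_sum]
    simp
  rw [key]
  refine contMDiffAt_finsetSum fun i _ ↦ ?_
  exact ((ContinuousLinearMap.smulRightL ℝ E F
      (LinearMap.toContinuousLinearMap (b.coord i))).contDiff.contMDiff.contMDiffAt).comp x (h (b i))

variable [IsManifold (𝓡 n) ∞ M]

/-- The coordinate expression of a field of bilinear forms near `x`. -/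
theorem inCoordinates_bilin {x y : M}
    (hy : y ∈ (trivializationAt (EuclideanSpace ℝ (Fin n)) (TangentSpace (𝓡 n) : M → Type _) x).baseSet)
    (B : TangentSpace (𝓡 n) y →L[ℝ] TangentSpace (𝓡 n) y →L[ℝ] ℝ)
    (u w : EuclideanSpace ℝ (Fin n)) :
    inCoordinates (EuclideanSpace ℝ (Fin n)) (TangentSpace (𝓡 n) : M → Type _)
      (EuclideanSpace ℝ (Fin n) →L[ℝ] ℝ) (fun y : M ↦ TangentSpace (𝓡 n) y →L[ℝ] ℝ) x y x y B u w
      = B ((trivializationAt (EuclideanSpace ℝ (Fin n)) (TangentSpace (𝓡 n) : M → Type _) x).symm y u)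
        ((trivializationAt (EuclideanSpace ℝ (Fin n)) (TangentSpace (𝓡 n) : M → Type _) x).symm y w) := by
  have := inCoordinates_apply_eq₂ (𝕜 := ℝ) (F₃ := ℝ) (E₃ := Bundle.Trivial M ℝ)
    (ϕ := B) (v := u) (w := w) hy hy (Set.mem_univ _)
  simpa using! this

/-- The fields `extend u` have constant coordinates in the trivialization at `x`, so the functions
in `h` are the matrix entries of `B` near `x`. -/
theorem contMDiffAt_bilin_section {B : Π x : M, TangentSpace (𝓡 n) x →L[ℝ] TangentSpace (𝓡 n) x →L[ℝ] ℝ}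
    {x : M}
    (h : ∀ u w : TangentSpace (𝓡 n) x, ContMDiffAt (𝓡 n) 𝓘(ℝ, ℝ) ∞
      (fun y ↦ B y (extend (EuclideanSpace ℝ (Fin n)) u y)
        (extend (EuclideanSpace ℝ (Fin n)) w y)) x) :
    ContMDiffAt (𝓡 n)
      ((𝓡 n).prod 𝓘(ℝ, EuclideanSpace ℝ (Fin n) →L[ℝ] EuclideanSpace ℝ (Fin n) →L[ℝ] ℝ)) ∞
      (fun x ↦ TotalSpace.mk'
        (EuclideanSpace ℝ (Fin n) →L[ℝ] EuclideanSpace ℝ (Fin n) →L[ℝ] ℝ) x (B x)) x := by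
  rw [contMDiffAt_hom_bundle]
  refine ⟨contMDiffAt_id, contMDiffAt_clm_of_forall_apply fun u ↦
    contMDiffAt_clm_of_forall_apply fun w ↦ ?_⟩
  set t := trivializationAt (EuclideanSpace ℝ (Fin n)) (TangentSpace (𝓡 n) : M → Type _) x with ht
  have hx : x ∈ t.baseSet := mem_baseSet_trivializationAt' x
  refine (h (t.symm x u) (t.symm x w)).congr_of_eventuallyEq ?_
  filter_upwards [t.open_baseSet.mem_nhds hx] with y hy
  refine (inCoordinates_bilin hy (B y) u w).trans ?_
  simp only [FiberBundle.extend, ← ht, t.apply_mk_symm hx]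

/-- The base map `b` allows fields along a map, such as `dp Z` along `p`, besides the case `b = id`.
-/
theorem contMDiffAt_bilin_apply {X : Type*} {m : ℕ} [TopologicalSpace X]
    [ChartedSpace (EuclideanSpace ℝ (Fin m)) X]
    {B : Π x : M, TangentSpace (𝓡 n) x →L[ℝ] TangentSpace (𝓡 n) x →L[ℝ] ℝ}
    (hB : ContMDiff (𝓡 n)
      ((𝓡 n).prod 𝓘(ℝ, EuclideanSpace ℝ (Fin n) →L[ℝ] EuclideanSpace ℝ (Fin n) →L[ℝ] ℝ)) ∞
      (fun x ↦ TotalSpace.mk'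
        (EuclideanSpace ℝ (Fin n) →L[ℝ] EuclideanSpace ℝ (Fin n) →L[ℝ] ℝ) x (B x)))
    {b : X → M} {x : X} {V W : Π y : X, TangentSpace (𝓡 n) (b y)}
    (hb : ContMDiffAt (𝓡 m) (𝓡 n) ∞ b x)
    (hV : ContMDiffAt (𝓡 m) (𝓡 n).tangent ∞ (fun y ↦ (⟨b y, V y⟩ : TangentBundle (𝓡 n) M)) x)
    (hW : ContMDiffAt (𝓡 m) (𝓡 n).tangent ∞ (fun y ↦ (⟨b y, W y⟩ : TangentBundle (𝓡 n) M)) x) :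
    ContMDiffAt (𝓡 m) 𝓘(ℝ, ℝ) ∞ (fun y ↦ B (b y) (V y) (W y)) x := by
  have h1 := ContMDiffAt.clm_bundle_apply₂ (F₃ := ℝ) (E₃ := Bundle.Trivial M ℝ) (n := ∞)
    (b := b) (ψ := fun y ↦ B (b y)) (v := V) (w := W) (x := x)
    ((hB.contMDiffAt (x := b x)).comp x hb) hV hW
  exact (contMDiffAt_totalSpace.1 h1).2

/-- A vector field is smooth at `x` if its contractions with a metric are. -/
theorem PseudoMetric.contMDiffAt_field (g : PseudoMetric n M) {Z : Π x : M, TangentSpace (𝓡 n) x}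
    {x : M} (h : ∀ w : TangentSpace (𝓡 n) x, ContMDiffAt (𝓡 n) 𝓘(ℝ, ℝ) ∞
      (fun y ↦ g.form y (Z y) (extend (EuclideanSpace ℝ (Fin n)) w y)) x) :
    ContMDiffAt (𝓡 n) (𝓡 n).tangent ∞ (fun y ↦ (⟨y, Z y⟩ : TangentBundle (𝓡 n) M)) x := by
  set t := trivializationAt (EuclideanSpace ℝ (Fin n)) (TangentSpace (𝓡 n) : M → Type _) x with ht
  have hx : x ∈ t.baseSet := mem_baseSet_trivializationAt' x
  have hG := ((contMDiffAt_hom_bundle _).1 (g.smooth.contMDiffAt (x := x))).2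
  set G : M → EuclideanSpace ℝ (Fin n) →L[ℝ] EuclideanSpace ℝ (Fin n) →L[ℝ] ℝ :=
    fun y ↦ inCoordinates (EuclideanSpace ℝ (Fin n)) (TangentSpace (𝓡 n) : M → Type _)
      (EuclideanSpace ℝ (Fin n) →L[ℝ] ℝ) (fun y : M ↦ TangentSpace (𝓡 n) y →L[ℝ] ℝ) x y x y
      (g.form y) with hGdef
  have hGapply : ∀ y ∈ t.baseSet, ∀ u w, G y u w = g.form y (t.symm y u) (t.symm y w) :=
    fun y hy u w ↦ inCoordinates_bilin hy (g.form y) u w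
  -- `G` is the Gram matrix of `g` in the trivialization. It is injective by non-degeneracy, hence
  -- invertible by dimension. The coordinates of `Z` are then `G⁻¹` applied to the covector `g(Z,
  -- ·)`, and inversion is smooth at invertible maps.
  have hinv : ∀ y ∈ t.baseSet, (G y).IsInvertible := by
    intro y hy
    have hinj : Function.Injective (G y) := by
      rw [injective_iff_map_eq_zero]
      intro u hu
      have h0 : t.symm y u = 0 := g.nondegenerate y _ fun w ↦ by
        have := hGapply y hy u (t ⟨y, w⟩).2
        rw [hu] at this
        rw [Trivialization.symm_apply_apply_mk t hy] at this
        simpa using this.symm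
      have h1 := Trivialization.apply_mk_symm t hy u
      rw [h0] at h1
      have h2 := t.zeroSection ℝ hy
      simp only [zeroSection] at h2
      have := h1.symm.trans h2
      simpa using this
    refine ⟨(LinearEquiv.ofInjectiveOfFinrankEq (G y).toLinearMap hinj ?_).toContinuousLinearEquiv, ?_⟩
    · rw [← LinearEquiv.finrank_eq (LinearMap.toContinuousLinearMap
        (𝕜 := ℝ) (E := EuclideanSpace ℝ (Fin n)) (F' := ℝ)), Subspace.dual_finrank_eq]
    · ext u; rfl
  rw [contMDiffAt_section]
  have hinvG : ContMDiffAt (𝓡 n) 𝓘(ℝ, (EuclideanSpace ℝ (Fin n) →L[ℝ] ℝ) →L[ℝ]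
      EuclideanSpace ℝ (Fin n)) ∞ (fun y ↦ (G y).inverse) x :=
    ContMDiffAt.comp (I' := 𝓘(ℝ, EuclideanSpace ℝ (Fin n) →L[ℝ] EuclideanSpace ℝ (Fin n) →L[ℝ] ℝ)) x
      (hinv x hx).contDiffAt_map_inverse.contMDiffAt hG
  have hζ : ContMDiffAt (𝓡 n) 𝓘(ℝ, EuclideanSpace ℝ (Fin n) →L[ℝ] ℝ) ∞
      (fun y ↦ G y (t ⟨y, Z y⟩).2) x := by
    refine contMDiffAt_clm_of_forall_apply fun w ↦ ?_
    refine (h (t.symm x w)).congr_of_eventuallyEq ?_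
    filter_upwards [t.open_baseSet.mem_nhds hx] with y hy
    rw [hGapply y hy, Trivialization.symm_apply_apply_mk t hy]
    simp [FiberBundle.extend, ← ht, hx]
  refine (hinvG.clm_apply hζ).congr_of_eventuallyEq ?_
  filter_upwards [t.open_baseSet.mem_nhds hx] with y hy
  exact ((hinv y hy).inverse_apply_eq.2 rfl).symm

/-- A vector field that is smooth on an open set agrees near each of its points with a global
smooth vector field. -/
theorem exists_smooth_eventuallyEq [T2Space M] {U : Set M} (hU : IsOpen U)
    {X : Π x : M, TangentSpace (𝓡 n) x} (hX : SmoothFieldOn U X) {x : M} (hx : x ∈ U) :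
    ∃ X' : Π x : M, TangentSpace (𝓡 n) x, SmoothFieldOn univ X' ∧ ∀ᶠ y in 𝓝 x, X' y = X y := by
  obtain ⟨f, -, hf⟩ := (SmoothBumpFunction.nhds_basis_tsupport (I := 𝓡 n) x).mem_iff.1 (hU.mem_nhds hx)
  refine ⟨(f : M → ℝ) • X, contMDiffOn_univ.2 ?_, ?_⟩
  · exact ContMDiffOn.smul_section_of_tsupport f.contMDiff.contMDiffOn hU hf hX
  · filter_upwards [f.eventuallyEq_one] with y hy
    simp [hy]

theorem SmoothFieldOn.contMDiffAt {U : Set M} {X : Π x : M, TangentSpace (𝓡 n) x}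
    (hX : SmoothFieldOn U X) {x : M} (hU : U ∈ 𝓝 x) :
    ContMDiffAt (𝓡 n) (𝓡 n).tangent ∞ (fun y ↦ (⟨y, X y⟩ : TangentBundle (𝓡 n) M)) x :=
  ContMDiffOn.contMDiffAt hX hU

theorem SmoothFieldOn.differentiableFieldAt {U : Set M} {X : Π x : M, TangentSpace (𝓡 n) x}
    (hX : SmoothFieldOn U X) {x : M} (hU : U ∈ 𝓝 x) : DifferentiableFieldAt X x :=
  (hX.contMDiffAt hU).mdifferentiableAt (by simp)

/-- Every tangent vector extends to a global smooth vector field. -/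
theorem exists_smooth_extension [T2Space M] {x : M} (v : TangentSpace (𝓡 n) x) :
    ∃ X : Π x : M, TangentSpace (𝓡 n) x, SmoothFieldOn univ X ∧
      ∀ᶠ y in 𝓝 x, X y = extend (EuclideanSpace ℝ (Fin n)) v y := by
  obtain ⟨s, hs, hsm⟩ := exists_contMDiffOn_extend (k := ∞) (𝓡 n) (EuclideanSpace ℝ (Fin n)) v
  obtain ⟨t, hts, ht, hxt⟩ := mem_nhds_iff.1 hs
  exact exists_smooth_eventuallyEq ht (hsm.mono hts) hxt

end Sections

end

end Presymplectic

namespace Presymplectic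

noncomputable section

/-! ### Lie brackets as commutators of derivations, and related fields -/

section Brackets

variable {n : ℕ} {M : Type*} [TopologicalSpace M] [ChartedSpace (EuclideanSpace ℝ (Fin n)) M]
  [IsManifold (𝓡 n) ∞ M]

-- In the chart at `x`, the function `Y h` is `DH(Y)`, with derivative `D²H(X, Y) + DH(DY X)` along
-- `X`. On exchanging `X` and `Y` and subtracting, the symmetric second derivative cancels and the
-- bracket remains. The same chart expression gives differentiability. Vector values are allowed so
-- that `h` can be built from a chart.
open VectorField in
theorem mdifferentiableAt_mvfderiv_and_mvfderiv_mlieBracket {F : Type*} [NormedAddCommGroup F] [NormedSpace ℝ F] {h : M → F} {x : M}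
    (hh : ContMDiffAt (𝓡 n) 𝓘(ℝ, F) ∞ h x) {X Y : Π x : M, TangentSpace (𝓡 n) x}
    (hX : DifferentiableFieldAt X x) (hY : DifferentiableFieldAt Y x) :
    MDifferentiableAt (𝓡 n) 𝓘(ℝ, F) (fun y ↦ mvfderiv (𝓡 n) h y (Y y)) x ∧
      mvfderiv (𝓡 n) h x (mlieBracket (𝓡 n) X Y x)
        = mvfderiv (𝓡 n) (fun y ↦ mvfderiv (𝓡 n) h y (Y y)) x (X x)
          - mvfderiv (𝓡 n) (fun y ↦ mvfderiv (𝓡 n) h y (X y)) x (Y x) := by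
  have : IsManifold (𝓡 n) 2 M := IsManifold.of_le (n := ∞) (by norm_cast)
  have : IsManifold (𝓡 n) 1 M := IsManifold.of_le (n := ∞) (by norm_cast)
  let E := EuclideanSpace ℝ (Fin n)
  set c := extChartAt (𝓡 n) x with hc
  -- `hat X` is the field `X` read in the extended chart at `x`.
  let hat (X : Π x : M, TangentSpace (𝓡 n) x) : E → E :=
    fun u ↦ mpullbackWithin 𝓘(ℝ, E) (𝓡 n) c.symm X (range (𝓡 n)) u
  have hhat : ∀ X : Π x : M, TangentSpace (𝓡 n) x, ∀ᶠ y in 𝓝 x,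
      mvfderiv (𝓡 n) c y (X y) = hat X (c y) := by
    intro X
    have h1 := eventuallyEq_mpullback_mpullbackWithin_extChartAt (I := 𝓡 n) (x := x) (s := univ) X
    rw [nhdsWithin_univ] at h1
    filter_upwards [h1, extChartAt_source_mem_nhds (I := 𝓡 n) x] with y hy hys
    rw [hy]
    exact (isInvertible_mfderiv_extChartAt hys).inverse_apply_eq.1 rfl |>.symm
  have hset : c.symm ⁻¹' univ ∩ range (𝓡 n) = univ := by
    rw [preimage_univ, univ_inter, ModelWithCorners.range_eq_univ]
  have hdiff : ∀ X : Π x : M, TangentSpace (𝓡 n) x, DifferentiableFieldAt X x →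
      DifferentiableAt ℝ (hat X) (c x) := by
    intro X hX
    have : DifferentiableWithinAt ℝ (hat X) (c.symm ⁻¹' univ ∩ range (𝓡 n)) (c x) :=
      MDifferentiableWithinAt.differentiableWithinAt_mpullbackWithin_vectorField
        (s := univ) (V := X) (x := x) (I := 𝓡 n) (by simpa using! hX)
    rwa [hset, differentiableWithinAt_univ] at this
  let H : E → F := h ∘ c.symm
  have hH : ContDiffAt ℝ ∞ H (c x) := by
    rw [← contMDiffAt_iff_contDiffAt]
    refine ContMDiffAt.comp_of_eq (y := x) (I' := 𝓡 n) hh ?_ (by simp [hc])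
    have := contMDiffWithinAt_extChartAt_symm_range_self (I := 𝓡 n) (n := ∞) x
    simpa using! this
  have hder : ∀ (k : E → F) (y : M), y ∈ c.source → DifferentiableAt ℝ k (c y) → ∀ (f : M → F),
      f =ᶠ[𝓝 y] k ∘ c → ∀ v, mvfderiv (𝓡 n) f y v = fderiv ℝ k (c y) (mvfderiv (𝓡 n) c y v) := by
    intro k y hy hk f hf v
    have hcy : MDifferentiableAt (𝓡 n) 𝓘(ℝ, E) c y :=
      mdifferentiableAt_extChartAt (by simpa [hc] using hy)
    have h1 : mfderiv (𝓡 n) 𝓘(ℝ, F) f y = mfderiv (𝓡 n) 𝓘(ℝ, F) (k ∘ c) y := hf.mfderiv_eq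
    rw [mfderiv_comp y hk.mdifferentiableAt hcy, mfderiv_eq_fderiv] at h1
    exact congrArg (fun A ↦ A v) h1
  have hev : ∀ᶠ y in 𝓝 x, y ∈ c.source ∧ DifferentiableAt ℝ H (c y) ∧ h =ᶠ[𝓝 y] H ∘ c := by
    have hs : ∀ᶠ y in 𝓝 x, y ∈ c.source := extChartAt_source_mem_nhds (I := 𝓡 n) x
    have h2 : ∀ᶠ u in 𝓝 (c x), DifferentiableAt ℝ H u := by
      have := (hH.of_le (m := 1) (by norm_cast)).eventually (by simp)
      exact this.mono fun u hu ↦ hu.differentiableAt (by simp)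
    filter_upwards [hs.eventually_nhds, (continuousAt_extChartAt (I := 𝓡 n) x).eventually h2]
      with y hy hy2
    refine ⟨hy.self_of_nhds, hy2, hy.mono fun z hz ↦ ?_⟩
    simp [H, c.left_inv hz]
  have hDH : DifferentiableAt ℝ (fderiv ℝ H) (c x) :=
    (hH.fderiv_right (m := 1) (by norm_cast)).differentiableAt (by simp)
  have hsymm : IsSymmSndFDerivAt ℝ H (c x) := hH.isSymmSndFDerivAt (by simp; norm_cast)
  have hread : ∀ Y : Π x : M, TangentSpace (𝓡 n) x, (fun y ↦ mvfderiv (𝓡 n) h y (Y y))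
      =ᶠ[𝓝 x] (fun u ↦ fderiv ℝ H u (hat Y u)) ∘ c := by
    intro Y
    filter_upwards [hhat Y, hev] with y hy hy2
    rw [hder H y hy2.1 hy2.2.1 h hy2.2.2, hy]
    rfl
  have hsecond : ∀ X Y : Π x : M, TangentSpace (𝓡 n) x, DifferentiableFieldAt Y x →
      mvfderiv (𝓡 n) (fun y ↦ mvfderiv (𝓡 n) h y (Y y)) x (X x)
        = fderiv ℝ (fderiv ℝ H) (c x) (hat X (c x)) (hat Y (c x))
          + fderiv ℝ H (c x) (fderiv ℝ (hat Y) (c x) (hat X (c x))) := by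
    intro X Y hY
    rw [hder (fun u ↦ fderiv ℝ H u (hat Y u)) x (mem_extChartAt_source x)
      (hDH.clm_apply (hdiff Y hY)) _ (hread Y), fderiv_clm_apply hDH (hdiff Y hY),
      (hhat X).self_of_nhds]
    simp [add_comm]
  have hbr : mvfderiv (𝓡 n) c x (mlieBracket (𝓡 n) X Y x) = lieBracket ℝ (hat X) (hat Y) (c x) := by
    have hlb : lieBracketWithin ℝ (hat X) (hat Y) (c.symm ⁻¹' univ ∩ range (𝓡 n)) (c x)
        = lieBracket ℝ (hat X) (hat Y) (c x) := by
      rw [hset, lieBracketWithin_univ]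
    have h1 : mlieBracket (𝓡 n) X Y x = (mfderiv (𝓡 n) 𝓘(ℝ, E) c x).inverse
        (lieBracket ℝ (hat X) (hat Y) (c x)) :=
      congrArg (fun w : E ↦ (mfderiv (𝓡 n) 𝓘(ℝ, E) c x).inverse w) hlb
    rw [h1]
    exact (isInvertible_mfderiv_extChartAt (mem_extChartAt_source x)).inverse_apply_eq.1 rfl |>.symm
  refine ⟨MDifferentiableAt.congr_of_eventuallyEq (MDifferentiableAt.comp x
    (hDH.clm_apply (hdiff Y hY)).mdifferentiableAt
    (mdifferentiableAt_extChartAt (mem_chart_source _ x))) (hread Y), ?_⟩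
  rw [hder H x (mem_extChartAt_source x) (hev.self_of_nhds).2.1 h (hev.self_of_nhds).2.2, hbr,
    hsecond X Y hY, hsecond Y X hX, hsymm.eq, lieBracket_eq]
  simp only [map_sub]
  abel

theorem mdifferentiableAt_mvfderiv_apply {F : Type*} [NormedAddCommGroup F] [NormedSpace ℝ F]
    {h : M → F} {x : M} (hh : ContMDiffAt (𝓡 n) 𝓘(ℝ, F) ∞ h x)
    {Y : Π x : M, TangentSpace (𝓡 n) x} (hY : DifferentiableFieldAt Y x) :
    MDifferentiableAt (𝓡 n) 𝓘(ℝ, F) (fun y ↦ mvfderiv (𝓡 n) h y (Y y)) x :=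
  (mdifferentiableAt_mvfderiv_and_mvfderiv_mlieBracket hh hY hY).1

open VectorField in
/-- A Lie bracket acts on functions as the commutator of derivations. -/
theorem mvfderiv_mlieBracket {F : Type*} [NormedAddCommGroup F] [NormedSpace ℝ F]
    {h : M → F} {x : M} (hh : ContMDiffAt (𝓡 n) 𝓘(ℝ, F) ∞ h x)
    {X Y : Π x : M, TangentSpace (𝓡 n) x} (hX : DifferentiableFieldAt X x)
    (hY : DifferentiableFieldAt Y x) :
    mvfderiv (𝓡 n) h x (mlieBracket (𝓡 n) X Y x)
      = mvfderiv (𝓡 n) (fun y ↦ mvfderiv (𝓡 n) h y (Y y)) x (X x)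
        - mvfderiv (𝓡 n) (fun y ↦ mvfderiv (𝓡 n) h y (X y)) x (Y x) :=
  (mdifferentiableAt_mvfderiv_and_mvfderiv_mlieBracket hh hX hY).2

variable {k : ℕ} {Q : Type*} [TopologicalSpace Q] [ChartedSpace (EuclideanSpace ℝ (Fin k)) Q]
  [IsManifold (𝓡 k) ∞ Q]

omit [IsManifold (𝓡 n) ∞ M] [IsManifold (𝓡 k) ∞ Q] in
theorem mvfderiv_comp_apply {F : Type*} [NormedAddCommGroup F] [NormedSpace ℝ F] {f : Q → F}
    {p : M → Q} {x : M} (hf : MDifferentiableAt (𝓡 k) 𝓘(ℝ, F) f (p x))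
    (hp : MDifferentiableAt (𝓡 n) (𝓡 k) p x) (v : TangentSpace (𝓡 n) x) :
    mvfderiv (𝓡 n) (fun y ↦ f (p y)) x v
      = mvfderiv (𝓡 k) f (p x) (mfderiv (𝓡 n) (𝓡 k) p x v) :=
  congrArg (fun A ↦ A v) (mfderiv_comp x hf hp)

omit [IsManifold (𝓡 n) ∞ M] in
theorem mvfderiv_congr {F : Type*} [NormedAddCommGroup F] [NormedSpace ℝ F] {f f' : M → F} {x : M}
    (h : f =ᶠ[𝓝 x] f') (v : TangentSpace (𝓡 n) x) :
    mvfderiv (𝓡 n) f x v = mvfderiv (𝓡 n) f' x v :=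
  congrArg (fun A : EuclideanSpace ℝ (Fin n) →L[ℝ] F ↦ A v) (h.mfderiv_eq (I := 𝓡 n) (I' := 𝓘(ℝ, F)))

open VectorField in
/-- Brackets of related vector fields are related. -/
theorem mfderiv_mlieBracket_of_related {p : M → Q} {x : M}
    (hp : ContMDiff (𝓡 n) (𝓡 k) ∞ p) {X Y : Π x : M, TangentSpace (𝓡 n) x}
    {X' Y' : Π q : Q, TangentSpace (𝓡 k) q}
    (hX : DifferentiableFieldAt X x) (hY : DifferentiableFieldAt Y x)
    (hX' : DifferentiableFieldAt X' (p x)) (hY' : DifferentiableFieldAt Y' (p x))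
    (hXX' : ∀ᶠ y in 𝓝 x, mfderiv (𝓡 n) (𝓡 k) p y (X y) = X' (p y))
    (hYY' : ∀ᶠ y in 𝓝 x, mfderiv (𝓡 n) (𝓡 k) p y (Y y) = Y' (p y)) :
    mfderiv (𝓡 n) (𝓡 k) p x (mlieBracket (𝓡 n) X Y x) = mlieBracket (𝓡 k) X' Y' (p x) := by
  -- As `p` need not be invertible, the brackets are compared as derivations: both sides act on the
  -- vector-valued function `ψ`, whose differential at `p x` is injective.
  set ψ := extChartAt (𝓡 k) (p x) with hψ
  have hψx : ContMDiffAt (𝓡 k) 𝓘(ℝ, EuclideanSpace ℝ (Fin k)) ∞ ψ (p x) := contMDiffAt_extChartAt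
  have hpd : ∀ y, MDifferentiableAt (𝓡 n) (𝓡 k) p y := fun y ↦ (hp y).mdifferentiableAt (by simp)
  have hread : ∀ (Z : Π x : M, TangentSpace (𝓡 n) x) (Z' : Π q : Q, TangentSpace (𝓡 k) q),
      (∀ᶠ y in 𝓝 x, mfderiv (𝓡 n) (𝓡 k) p y (Z y) = Z' (p y)) →
      (fun y ↦ mvfderiv (𝓡 n) (fun z ↦ ψ (p z)) y (Z y))
        =ᶠ[𝓝 x] fun y ↦ (fun q ↦ mvfderiv (𝓡 k) ψ q (Z' q)) (p y) := by
    intro Z Z' hZ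
    have hs : ∀ᶠ y in 𝓝 x, p y ∈ (extChartAt (𝓡 k) (p x)).source :=
      (hp x).continuousAt.eventually (extChartAt_source_mem_nhds (I := 𝓡 k) (p x))
    filter_upwards [hZ, hs] with y hy hys
    rw [mvfderiv_comp_apply (mdifferentiableAt_extChartAt (by simpa using hys)) (hpd y), hy]
  have hbr := mvfderiv_mlieBracket (h := fun z ↦ ψ (p z)) (hψx.comp x (hp x)) hX hY
  rw [mvfderiv_congr (hread Y Y' hYY'), mvfderiv_congr (hread X X' hXX'),
    mvfderiv_comp_apply (mdifferentiableAt_mvfderiv_apply hψx hY') (hpd x),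
    mvfderiv_comp_apply (mdifferentiableAt_mvfderiv_apply hψx hX') (hpd x),
    hXX'.self_of_nhds, hYY'.self_of_nhds, ← mvfderiv_mlieBracket hψx hX' hY',
    mvfderiv_comp_apply (hψx.mdifferentiableAt (by simp)) (hpd x)] at hbr
  exact (isInvertible_mfderiv_extChartAt (mem_extChartAt_source (p x))).injective hbr

end Brackets

end

end Presymplectic

namespace Presymplectic

noncomputable section

/-! ### Local normal form of submersions: sections, lifts, functions constant on fibres -/

section Submersions

variable {n k : ℕ}
  {N : Type*} [TopologicalSpace N] [ChartedSpace (EuclideanSpace ℝ (Fin n)) N]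
  [IsManifold (𝓡 n) ∞ N]
  {Q : Type*} [TopologicalSpace Q] [ChartedSpace (EuclideanSpace ℝ (Fin k)) Q]
  [IsManifold (𝓡 k) ∞ Q]

omit [IsManifold (𝓡 n) ∞ N] in
theorem mdifferentiable_of_mem_maximalAtlas
    {φ : OpenPartialHomeomorph N (EuclideanSpace ℝ (Fin n))}
    (hφ : φ ∈ IsManifold.maximalAtlas (𝓡 n) ∞ N) : φ.MDifferentiable (𝓡 n) (𝓡 n) :=
  ⟨(contMDiffOn_of_mem_maximalAtlas hφ).mdifferentiableOn (by simp),
    (contMDiffOn_symm_of_mem_maximalAtlas hφ).mdifferentiableOn (by simp)⟩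

/-- Charts in which a map is the first projection of a product, on the domain of the first chart. -/
structure SubmersionChart (p : N → Q) (x : N) (F : Type) [NormedAddCommGroup F]
    [NormedSpace ℝ F] where
  dom : OpenPartialHomeomorph N (EuclideanSpace ℝ (Fin n))
  cod : OpenPartialHomeomorph Q (EuclideanSpace ℝ (Fin k))
  equiv : EuclideanSpace ℝ (Fin n) ≃L[ℝ] EuclideanSpace ℝ (Fin k) × F
  dom_mem : dom ∈ IsManifold.maximalAtlas (𝓡 n) ∞ N
  cod_mem : cod ∈ IsManifold.maximalAtlas (𝓡 k) ∞ Q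
  mem_source : x ∈ dom.source
  mapsTo : MapsTo p dom.source cod.source
  cod_apply : ∀ y ∈ dom.source, cod (p y) = (equiv (dom y)).1

theorem exists_submersionChart {p : N → Q} (hp : Manifold.IsSubmersion (𝓡 n) (𝓡 k) ∞ p) (x : N) :
    ∃ (F : Type) (_ : NormedAddCommGroup F) (_ : NormedSpace ℝ F),
      Nonempty (SubmersionChart (n := n) (k := k) p x F) := by
  obtain ⟨F, _, _, h⟩ := hp
  have hx := h x
  refine ⟨F, _, _, ⟨⟨hx.domChart, hx.codChart, hx.equiv, hx.domChart_mem_maximalAtlas,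
    hx.codChart_mem_maximalAtlas, hx.mem_domChart_source, hx.mapsto_domChart_source_codChart_source,
    fun y hy ↦ ?_⟩⟩⟩
  have hmem : hx.domChart y ∈ (hx.domChart.extend (𝓡 n)).target := by
    simpa using hx.domChart.map_source hy
  have := hx.writtenInCharts hmem
  simpa [hx.domChart.left_inv hy] using this

namespace SubmersionChart

variable {p : N → Q} {x : N} {F : Type} [NormedAddCommGroup F] [NormedSpace ℝ F]
  (c : SubmersionChart (n := n) (k := k) p x F)

include c

theorem mfderiv_cod_comp (hp : ContMDiff (𝓡 n) (𝓡 k) ∞ p) {y : N} (hy : y ∈ c.dom.source)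
    (v : TangentSpace (𝓡 n) y) :
    (show EuclideanSpace ℝ (Fin k) from
      mfderiv (𝓡 k) (𝓡 k) c.cod (p y) (mfderiv (𝓡 n) (𝓡 k) p y v))
      = (c.equiv (show EuclideanSpace ℝ (Fin n) from mfderiv (𝓡 n) (𝓡 n) c.dom y v)).1 := by
  let A : EuclideanSpace ℝ (Fin n) →L[ℝ] EuclideanSpace ℝ (Fin k) :=
    (ContinuousLinearMap.fst ℝ _ F) ∘L (c.equiv : EuclideanSpace ℝ (Fin n) →L[ℝ] _)
  have h1 : (c.cod ∘ p) =ᶠ[𝓝 y] A ∘ c.dom := by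
    filter_upwards [c.dom.open_source.mem_nhds hy] with z hz using c.cod_apply z hz
  have h2 := h1.mfderiv_eq (I := 𝓡 n) (I' := 𝓡 k)
  rw [mfderiv_comp (I' := 𝓡 k) y ((mdifferentiable_of_mem_maximalAtlas c.cod_mem).mdifferentiableAt (c.mapsTo hy))
      ((hp y).mdifferentiableAt (by simp)),
    mfderiv_comp (I' := 𝓡 n) y A.mdifferentiableAt
      ((mdifferentiable_of_mem_maximalAtlas c.dom_mem).mdifferentiableAt hy),
    ContinuousLinearMap.mfderiv_eq] at h2
  exact congrArg (fun B : EuclideanSpace ℝ (Fin n) →L[ℝ] EuclideanSpace ℝ (Fin k) ↦ B v) h2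

/-- A submersion has a smooth local section through each point. -/
theorem exists_section : ∃ s : Q → N, ContMDiffAt (𝓡 k) (𝓡 n) ∞ s (p x) ∧ s (p x) = x ∧
    ∀ᶠ q in 𝓝 (p x), p (s q) = q := by
  have hpx : p x ∈ c.cod.source := c.mapsTo c.mem_source
  -- The section is the slice through `x` on which the fibre coordinate keeps its value at `x`.
  let j : EuclideanSpace ℝ (Fin k) → EuclideanSpace ℝ (Fin n) :=
    fun u ↦ c.equiv.symm (u, (c.equiv (c.dom x)).2)
  have hj : ContDiff ℝ ∞ j := c.equiv.symm.contDiff.comp (contDiff_id.prodMk contDiff_const)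
  have hjx : j (c.cod (p x)) = c.dom x := by
    simp [j, c.cod_apply x c.mem_source]
  have hcod : ContMDiffAt (𝓡 k) (𝓡 k) ∞ c.cod (p x) :=
    contMDiffAt_of_mem_maximalAtlas c.cod_mem hpx
  have hjcod : ContMDiffAt (𝓡 k) (𝓡 n) ∞ (fun q ↦ j (c.cod q)) (p x) :=
    (hj.contMDiff (n := ∞)).contMDiffAt.comp (p x) hcod
  refine ⟨fun q ↦ c.dom.symm (j (c.cod q)), ?_, ?_, ?_⟩
  · refine ContMDiffAt.comp_of_eq (y := c.dom x) (I' := 𝓡 n) ?_ hjcod hjx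
    exact contMDiffAt_symm_of_mem_maximalAtlas c.dom_mem (c.dom.map_source c.mem_source)
  · simp [hjx, c.dom.left_inv c.mem_source]
  · have h1 : ∀ᶠ q in 𝓝 (p x), j (c.cod q) ∈ c.dom.target :=
      hjcod.continuousAt.eventually (c.dom.open_target.mem_nhds
        (by simpa only [hjx] using c.dom.map_source c.mem_source))
    filter_upwards [h1, c.cod.open_source.mem_nhds hpx] with q hq hqs
    have hs := c.dom.map_target hq
    refine c.cod.injOn (c.mapsTo hs) hqs ?_
    rw [c.cod_apply _ hs, c.dom.right_inv hq]
    simp [j]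

/-- The differential of `cod` is injective, so `dp` may be read in coordinates, where it is the
first projection. In particular a vector is vertical iff its first component vanishes. -/
theorem mfderiv_eq_iff (hp : ContMDiff (𝓡 n) (𝓡 k) ∞ p) {y : N} (hy : y ∈ c.dom.source)
    (v : TangentSpace (𝓡 n) y) (w : TangentSpace (𝓡 k) (p y)) :
    mfderiv (𝓡 n) (𝓡 k) p y v = w ↔
      (c.equiv (show EuclideanSpace ℝ (Fin n) from mfderiv (𝓡 n) (𝓡 n) c.dom y v)).1
        = (show EuclideanSpace ℝ (Fin k) from mfderiv (𝓡 k) (𝓡 k) c.cod (p y) w) := by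
  rw [← c.mfderiv_cod_comp hp hy]
  exact ((mdifferentiable_of_mem_maximalAtlas c.cod_mem).mfderiv_injective
    (c.mapsTo hy)).eq_iff.symm

theorem mfderiv_surjective (hp : ContMDiff (𝓡 n) (𝓡 k) ∞ p) {y : N} (hy : y ∈ c.dom.source) :
    Function.Surjective (mfderiv (𝓡 n) (𝓡 k) p y) := by
  intro w
  obtain ⟨v, hv⟩ := (mdifferentiable_of_mem_maximalAtlas c.dom_mem).mfderiv_surjective hy
    (c.equiv.symm ((show EuclideanSpace ℝ (Fin k) from mfderiv (𝓡 k) (𝓡 k) c.cod (p y) w), 0))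
  exact ⟨v, (c.mfderiv_eq_iff hp hy v w).2
    (congrArg Prod.fst ((congrArg c.equiv hv).trans (c.equiv.apply_symm_apply _)))⟩

/-- Smooth vector fields lift through submersions, locally. -/
theorem exists_lift [T2Space N] (hp : ContMDiff (𝓡 n) (𝓡 k) ∞ p) {V : Set Q} (hV : IsOpen V)
    (hx : p x ∈ V) {Z' : Π q : Q, TangentSpace (𝓡 k) q} (hZ' : SmoothFieldOn V Z') :
    ∃ Z : Π y : N, TangentSpace (𝓡 n) y, SmoothFieldOn univ Z ∧
      ∀ᶠ y in 𝓝 x, mfderiv (𝓡 n) (𝓡 k) p y (Z y) = Z' (p y) := by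
  have hdom := mdifferentiable_of_mem_maximalAtlas c.dom_mem
  have hcod := mdifferentiable_of_mem_maximalAtlas c.cod_mem
  -- `C'` is `Z'` in the chart of `Q`; the lift `C` has the same base component and zero fibre
  -- component.
  let C' : EuclideanSpace ℝ (Fin k) → EuclideanSpace ℝ (Fin k) :=
    VectorField.mpullback (𝓡 k) (𝓡 k) c.cod.symm Z'
  let C : EuclideanSpace ℝ (Fin n) → EuclideanSpace ℝ (Fin n) :=
    fun u ↦ c.equiv.symm (C' (c.equiv u).1, 0)
  let Z : Π y : N, TangentSpace (𝓡 n) y := VectorField.mpullback (𝓡 n) (𝓡 n) c.dom C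
  have hC' : ∀ q ∈ V ∩ c.cod.source, ContDiffAt ℝ ∞ C' (c.cod q) := by
    intro q hq
    rw [← contMDiffAt_vectorSpace_iff_contDiffAt]
    have ht := c.cod.map_source hq.2
    refine ContMDiffAt.mpullback_vectorField_preimage (n := ∞) ?_
      (contMDiffAt_symm_of_mem_maximalAtlas c.cod_mem ht) ⟨hcod.symm.mfderiv ht, rfl⟩ (by simp)
    rw [c.cod.left_inv hq.2]
    exact hZ'.contMDiffAt (hV.mem_nhds hq.1)
  let U : Set N := p ⁻¹' V ∩ c.dom.source
  have hU : IsOpen U := (hV.preimage hp.continuous).inter c.dom.open_source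
  have hZ : SmoothFieldOn U Z := by
    intro y hy
    refine ContMDiffAt.contMDiffWithinAt ?_
    refine ContMDiffAt.mpullback_vectorField_preimage (n := ∞) ?_
      (contMDiffAt_of_mem_maximalAtlas c.dom_mem hy.2) ⟨hdom.mfderiv hy.2, rfl⟩ (by simp)
    refine contMDiffAt_vectorSpace_iff_contDiffAt.2 ?_
    refine c.equiv.symm.contDiff.contDiffAt.comp _ (ContDiffAt.prodMk ?_ contDiffAt_const)
    refine ContDiffAt.comp (g := C') (c.dom y) ?_ (contDiff_fst.comp c.equiv.contDiff).contDiffAt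
    rw [← c.cod_apply y hy.2]
    exact hC' _ ⟨hy.1, c.mapsTo hy.2⟩
  obtain ⟨Z₁, hZ₁, hZZ₁⟩ := exists_smooth_eventuallyEq hU hZ (x := x) ⟨hx, c.mem_source⟩
  refine ⟨Z₁, hZ₁, ?_⟩
  filter_upwards [hZZ₁, hU.mem_nhds ⟨hx, c.mem_source⟩] with y hyZ hyU
  rw [hyZ, c.mfderiv_eq_iff hp hyU.2]
  have i1 : (mfderiv (𝓡 n) (𝓡 n) c.dom y).IsInvertible := ⟨hdom.mfderiv hyU.2, rfl⟩
  have h1 : mfderiv (𝓡 n) (𝓡 n) c.dom y (Z y) = C (c.dom y) := (i1.inverse_apply_eq.1 rfl).symm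
  have i2 : (mfderiv (𝓡 k) (𝓡 k) c.cod.symm (c.cod (p y))).IsInvertible :=
    ⟨hcod.symm.mfderiv (c.cod.map_source (c.mapsTo hyU.2)), rfl⟩
  have h2 : (mfderiv (𝓡 k) (𝓡 k) c.cod.symm (c.cod (p y))) (C' (c.cod (p y)))
      = Z' (c.cod.symm (c.cod (p y))) := (i2.inverse_apply_eq.1 rfl).symm
  have h3 := hcod.comp_symm_deriv (c.cod.map_source (c.mapsTo hyU.2))
  have h4 : C' (c.cod (p y)) = mfderiv (𝓡 k) (𝓡 k) c.cod (p y) (Z' (p y)) := by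
    have h5 := congrArg (fun B : EuclideanSpace ℝ (Fin k) →L[ℝ] EuclideanSpace ℝ (Fin k) ↦
      B (C' (c.cod (p y)))) h3
    refine h5.symm.trans ?_
    refine (congrArg (mfderiv (𝓡 k) (𝓡 k) c.cod (c.cod.symm (c.cod (p y)))) h2).trans ?_
    rw [c.cod.left_inv (c.mapsTo hyU.2)]
  rw [h1]
  simp only [C, ContinuousLinearEquiv.apply_symm_apply, ← c.cod_apply y hyU.2]
  exact h4

/-- A function whose differential vanishes on the vertical vectors near `x` is constant near `x`
on the fibre through `x`. -/
theorem eventually_eq_of_mvfderiv_eq_zero (hp : ContMDiff (𝓡 n) (𝓡 k) ∞ p) {f : N → ℝ}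
    (hf : ∀ᶠ y in 𝓝 x, MDifferentiableAt (𝓡 n) 𝓘(ℝ, ℝ) f y ∧
      ∀ v : TangentSpace (𝓡 n) y, mfderiv (𝓡 n) (𝓡 k) p y v = 0 → mvfderiv (𝓡 n) f y v = 0) :
    ∀ᶠ y in 𝓝 x, p y = p x → f y = f x := by
  have hdom := mdifferentiable_of_mem_maximalAtlas c.dom_mem
  have hxt := c.dom.map_source c.mem_source
  have h1 : ∀ᶠ u in 𝓝 (c.dom x), u ∈ c.dom.target ∧
      MDifferentiableAt (𝓡 n) 𝓘(ℝ, ℝ) f (c.dom.symm u) ∧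
      ∀ v : TangentSpace (𝓡 n) (c.dom.symm u), mfderiv (𝓡 n) (𝓡 k) p (c.dom.symm u) v = 0 →
        mvfderiv (𝓡 n) f (c.dom.symm u) v = 0 := by
    have ht : ∀ᶠ u in 𝓝 (c.dom x), u ∈ c.dom.target := c.dom.open_target.mem_nhds hxt
    exact ht.and ((c.dom.tendsto_symm c.mem_source).eventually hf)
  obtain ⟨ε, hε, hball⟩ := Metric.eventually_nhds_iff_ball.1 h1
  have h2 : ∀ᶠ y in 𝓝 x, c.dom y ∈ Metric.ball (c.dom x) ε :=
    (c.dom.continuousAt c.mem_source).eventually (Metric.ball_mem_nhds _ hε)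
  filter_upwards [h2, c.dom.open_source.mem_nhds c.mem_source] with y hy hys hpy
  set d : EuclideanSpace ℝ (Fin n) := c.dom y - c.dom x with hd
  have hd0 : (c.equiv d).1 = 0 := by
    rw [hd, map_sub, Prod.fst_sub, ← c.cod_apply y hys, ← c.cod_apply x c.mem_source, hpy, sub_self]
  -- Since `p y = p x`, the direction `d` has no base component, so the segment from `x` to `y` in
  -- the chart is vertical. It stays in the ball where the hypothesis on `f` holds.
  let γ : ℝ → EuclideanSpace ℝ (Fin n) := fun t ↦ c.dom x + t • d
  have hγ : ∀ t ∈ Icc (0 : ℝ) 1, γ t ∈ Metric.ball (c.dom x) ε := by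
    intro t ht
    rw [mem_ball_iff_norm] at hy ⊢
    simp only [γ, add_sub_cancel_left, norm_smul, Real.norm_eq_abs, abs_of_nonneg ht.1]
    exact (mul_le_of_le_one_left (norm_nonneg _) ht.2).trans_lt hy
  have hder : ∀ t ∈ Icc (0 : ℝ) 1, HasDerivAt (fun t ↦ f (c.dom.symm (γ t))) 0 t := by
    intro t ht
    obtain ⟨hut, hfd, hfv⟩ := hball _ (hγ t ht)
    have hsm := hdom.mdifferentiableAt_symm hut
    have hcomp : MDifferentiableAt (𝓡 n) 𝓘(ℝ, ℝ) (f ∘ c.dom.symm) (γ t) := hfd.comp _ hsm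
    have hfd' : DifferentiableAt ℝ (f ∘ c.dom.symm) (γ t) := hcomp.differentiableAt
    have hγd : HasDerivAt γ d t := by
      simpa [γ] using ((hasDerivAt_id t).smul_const d).const_add (c.dom x)
    have hmain := hfd'.hasFDerivAt.comp_hasDerivAt t hγd
    have hz : fderiv ℝ (f ∘ c.dom.symm) (γ t) d = 0 := by
      rw [← mfderiv_eq_fderiv]
      have h3 := mfderiv_comp (I := 𝓡 n) (I' := 𝓡 n) (I'' := 𝓘(ℝ, ℝ)) (γ t) hfd hsm
      refine (congrArg (fun B : EuclideanSpace ℝ (Fin n) →L[ℝ] ℝ ↦ B d) h3).trans ?_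
      refine hfv _ ?_
      have hs := c.dom.map_target hut
      rw [c.mfderiv_eq_iff hp hs, map_zero]
      have h4 := hdom.comp_symm_deriv hut
      have h5 := congrArg (fun B : EuclideanSpace ℝ (Fin n) →L[ℝ] EuclideanSpace ℝ (Fin n) ↦ B d) h4
      refine (congrArg (fun u ↦ (c.equiv u).1) h5).trans hd0
    rw [hz] at hmain
    exact hmain
  have hconst := constant_of_has_deriv_right_zero (a := 0) (b := 1)
    (f := fun t ↦ f (c.dom.symm (γ t)))
    (fun t ht ↦ (hder t ht).continuousAt.continuousWithinAt)
    (fun t ht ↦ (hder t ⟨ht.1, ht.2.le⟩).hasDerivWithinAt) 1 (by simp)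
  simpa [γ, d, c.dom.left_inv hys, c.dom.left_inv c.mem_source] using hconst

end SubmersionChart

end Submersions

end

end Presymplectic

namespace Presymplectic

noncomputable section

/-! ### The annihilator is the vertical distribution -/

section Vertical

variable {n k : ℕ}
  {N : Type*} [TopologicalSpace N] [ChartedSpace (EuclideanSpace ℝ (Fin n)) N]
  [IsManifold (𝓡 n) ∞ N]
  {Q : Type*} [TopologicalSpace Q] [ChartedSpace (EuclideanSpace ℝ (Fin k)) Q]
  [IsManifold (𝓡 k) ∞ Q]

/-- A map that is constant on the leaves of a foliation kills its tangent vectors. -/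
theorem mfderiv_eq_zero_of_constant_on_leaves {c : ℕ} {K : Π x : N, Submodule ℝ (TangentSpace (𝓡 n) x)}
    (hK : IsTangentToFoliation c K) {p : N → Q} (hp : ContMDiff (𝓡 n) (𝓡 k) ∞ p)
    (hleaf : ∀ x : N, ∀ y ∈ leaf K x, p y = p x) {x : N} {v : TangentSpace (𝓡 n) x} (hv : v ∈ K x) :
    mfderiv (𝓡 n) (𝓡 k) p x v = 0 := by
  obtain ⟨φ, hφ, hx, hφK⟩ := hK x
  have hd := mdifferentiable_of_mem_maximalAtlas hφ
  set w : EuclideanSpace ℝ (Fin n) := mfderiv (𝓡 n) (𝓡 n) φ x v with hw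
  have hwc : ∀ i : Fin n, (i : ℕ) < c → w i = 0 := (hφK x hx v).1 hv
  obtain ⟨ε, hε, hball⟩ := Metric.isOpen_iff.1 φ.open_target (φ x) (φ.map_source hx)
  obtain ⟨δ, hδ, hδw⟩ : ∃ δ : ℝ, 0 < δ ∧ δ * ‖w‖ < ε := by
    refine ⟨ε / (‖w‖ + 1), by positivity, ?_⟩
    rw [div_mul_eq_mul_div, div_lt_iff₀ (by positivity)]
    nlinarith [norm_nonneg w]
  -- Leaves are defined by curves on all of `ℝ`; the bounded sine keeps the line through `φ x` in
  -- direction `w` inside the chart for all times.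
  let u : (ℝ → ℝ) → ℝ → EuclideanSpace ℝ (Fin n) := fun a t ↦ φ x + (δ * Real.sin (a t)) • w
  have hu : ∀ a t, u a t ∈ φ.target := by
    intro a t
    refine hball ?_
    rw [mem_ball_iff_norm]
    simp only [u, add_sub_cancel_left, norm_smul, norm_mul, Real.norm_eq_abs, abs_of_pos hδ]
    refine lt_of_le_of_lt ?_ hδw
    gcongr
    exact mul_le_of_le_one_right hδ.le (Real.abs_sin_le_one _)
  -- The reparametrization `a t = s * t` reaches `u id s` at time `1`. It is tangent to `K` because
  -- its velocity is a multiple of `w`, whose first `c` coordinates vanish.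
  have hcurve : ∀ s : ℝ, p (φ.symm (u id s)) = p x := by
    intro s
    refine hleaf x _ (Relation.EqvGen.rel _ _ ⟨fun t ↦ φ.symm (u (fun t ↦ s * t) t), ?_, ?_, ?_, ?_⟩)
    · have h1 : ContDiff ℝ ∞ (u fun t ↦ s * t) := by
        simp only [u]; fun_prop
      exact (contMDiffOn_symm_of_mem_maximalAtlas hφ).comp_contMDiff h1.contMDiff (hu _)
    · simp [u, φ.left_inv hx]
    · simp [u]
    · intro t
      have h1 : HasDerivAt (u fun t ↦ s * t) ((δ * (Real.cos (s * t) * s)) • w) t := by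
        have h0 : HasDerivAt (fun t : ℝ ↦ s * t) s t := by simpa using (hasDerivAt_id t).const_mul s
        exact ((h0.sin.const_mul δ).smul_const w).const_add (φ x)
      have h2 : mfderiv 𝓘(ℝ, ℝ) (𝓡 n) (fun t ↦ φ.symm (u (fun t ↦ s * t) t)) t (1 : ℝ)
          = mfderiv (𝓡 n) (𝓡 n) φ.symm (u (fun t ↦ s * t) t) ((δ * (Real.cos (s * t) * s)) • w) := by
        have h3 := mfderiv_comp (I := 𝓘(ℝ, ℝ)) (I' := 𝓡 n) (I'' := 𝓡 n) (g := φ.symm)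
          (f := u fun t ↦ s * t) t
          (hd.mdifferentiableAt_symm (hu _ t)) h1.differentiableAt.mdifferentiableAt
        rw [mfderiv_eq_fderiv] at h3
        have h4 : fderiv ℝ (u fun t ↦ s * t) t 1 = (δ * (Real.cos (s * t) * s)) • w := by
          rw [fderiv_apply_one_eq_deriv, h1.deriv]
        refine (congrArg (fun B : ℝ →L[ℝ] EuclideanSpace ℝ (Fin n) ↦ B 1) h3).trans ?_
        exact congrArg (mfderiv (𝓡 n) (𝓡 n) φ.symm (u (fun t ↦ s * t) t)) h4
      rw [h2]
      refine (hφK _ (φ.map_target (hu _ t)) _).2 fun i hi ↦ ?_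
      have h5 := hd.comp_symm_deriv (hu (fun t ↦ s * t) t)
      have h6 := congrArg (fun B : EuclideanSpace ℝ (Fin n) →L[ℝ] EuclideanSpace ℝ (Fin n) ↦
        B ((δ * (Real.cos (s * t) * s)) • w) i) h5
      refine h6.trans ?_
      change (δ * (Real.cos (s * t) * s)) * w i = 0
      rw [hwc i hi, mul_zero]
  -- Differentiating the constant `p` along the curve at time `0` gives `dp (δ v) = 0`, with `δ ≠
  -- 0`.
  have h1 : HasDerivAt (u id) (δ • w) 0 := by
    have h0 := ((hasDerivAt_id (0 : ℝ)).sin.const_mul δ)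
    simpa [u] using! (h0.smul_const w).const_add (φ x)
  have hux : u id 0 = φ x := by simp [u]
  have hsm := hd.mdifferentiableAt_symm (hu id 0)
  have h2 := mfderiv_comp (I := 𝓘(ℝ, ℝ)) (I' := 𝓡 n) (I'' := 𝓡 n) (g := φ.symm) (f := u id) 0 hsm
    h1.differentiableAt.mdifferentiableAt
  have h3 := mfderiv_comp (I := 𝓘(ℝ, ℝ)) (I' := 𝓡 n) (I'' := 𝓡 k) (g := p) (f := φ.symm ∘ u id) 0
    ((hp _).mdifferentiableAt (by simp)) (hsm.comp _ h1.differentiableAt.mdifferentiableAt)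
  have h4 : p ∘ φ.symm ∘ u id = fun _ ↦ p x := funext hcurve
  rw [h4, mfderiv_const, h2, mfderiv_eq_fderiv] at h3
  have h5 : fderiv ℝ (u id) 0 1 = δ • w := by rw [fderiv_apply_one_eq_deriv, h1.deriv]
  have h6 := congrArg (fun B : ℝ →L[ℝ] EuclideanSpace ℝ (Fin k) ↦ B 1) h3
  have h7 : mfderiv (𝓡 n) (𝓡 k) p (φ.symm (u id 0))
      (mfderiv (𝓡 n) (𝓡 n) φ.symm (u id 0) (δ • w)) = 0 := by
    refine Eq.trans ?_ h6.symm
    exact congrArg (fun d ↦ mfderiv (𝓡 n) (𝓡 k) p (φ.symm (u id 0))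
      (mfderiv (𝓡 n) (𝓡 n) φ.symm (u id 0) d)) h5.symm
  rw [hux, φ.left_inv hx] at h7
  have h8 : mfderiv (𝓡 n) (𝓡 n) φ.symm (φ x) w = v :=
    congrArg (fun B : EuclideanSpace ℝ (Fin n) →L[ℝ] EuclideanSpace ℝ (Fin n) ↦ B v)
      (hd.symm_comp_deriv hx)
  have h9 : mfderiv (𝓡 n) (𝓡 n) φ.symm (φ x) (δ • w) = δ • v :=
    (map_smul (mfderiv (𝓡 n) (𝓡 n) φ.symm (φ x)) δ w).trans (congrArg (δ • ·) h8)
  have h10 : mfderiv (𝓡 n) (𝓡 k) p x (δ • v) = 0 :=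
    (congrArg (mfderiv (𝓡 n) (𝓡 k) p x) h9.symm).trans h7
  rw [map_smul] at h10
  exact (smul_eq_zero.1 h10).resolve_left hδ.ne'

theorem mfderiv_surjective_of_isSubmersion {p : N → Q}
    (hp : Manifold.IsSubmersion (𝓡 n) (𝓡 k) ∞ p) (x : N) :
    Function.Surjective (mfderiv (𝓡 n) (𝓡 k) p x) := by
  obtain ⟨F, _, _, ⟨c⟩⟩ := exists_submersionChart hp x
  exact c.mfderiv_surjective hp.contMDiff c.mem_source

/-- Under the rank condition, the annihilator is the vertical distribution of the submersion. -/
theorem TwoForm.mem_ann_iff_mfderiv_eq_zero {Ω : TwoForm n N} (hrank : Ω.HasConstantRank k) {c : ℕ}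
    (hfol : IsTangentToFoliation c Ω.ann) {p : N → Q}
    (hp : Manifold.IsSubmersion (𝓡 n) (𝓡 k) ∞ p)
    (hleaf : ∀ x : N, ∀ y ∈ leaf Ω.ann x, p y = p x) (x : N) (v : TangentSpace (𝓡 n) x) :
    v ∈ Ω.ann x ↔ mfderiv (𝓡 n) (𝓡 k) p x v = 0 := by
  have : FiniteDimensional ℝ (TangentSpace (𝓡 n) x) :=
    inferInstanceAs (FiniteDimensional ℝ (EuclideanSpace ℝ (Fin n)))
  have hdimk : Module.finrank ℝ (TangentSpace (𝓡 k) (p x)) = k :=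
    finrank_euclideanSpace_fin (𝕜 := ℝ)
  have h1 := LinearMap.finrank_range_add_finrank_ker (Ω.form x).toLinearMap
  have h2 := LinearMap.finrank_range_add_finrank_ker (mfderiv (𝓡 n) (𝓡 k) p x).toLinearMap
  rw [hrank x] at h1
  rw [LinearMap.range_eq_top.2 (mfderiv_surjective_of_isSubmersion hp x), finrank_top, hdimk] at h2
  have h3 : Ω.ann x = LinearMap.ker (mfderiv (𝓡 n) (𝓡 k) p x).toLinearMap := by
    -- One inclusion comes from the leaves; rank-nullity for `Ω_x` and for `dp`, both of rank `k`,
    -- gives equal dimensions.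
    refine Submodule.eq_of_le_of_finrank_eq
      (fun v hv ↦ mfderiv_eq_zero_of_constant_on_leaves hfol hp.contMDiff hleaf hv) ?_
    have h4 : Module.finrank ℝ (Ω.ann x)
      = Module.finrank ℝ (LinearMap.ker (Ω.form x).toLinearMap) := rfl
    omega
  rw [h3]
  rfl

end Vertical

end

end Presymplectic

namespace Presymplectic

noncomputable section

/-! ### Descent of the two-form to the base -/

section Projection

open Bundle FiberBundle

variable {n k : ℕ}
  {N : Type*} [TopologicalSpace N] [ChartedSpace (EuclideanSpace ℝ (Fin n)) N]
  [IsManifold (𝓡 n) ∞ N] [T2Space N]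
  {Q : Type*} [TopologicalSpace Q] [ChartedSpace (EuclideanSpace ℝ (Fin k)) Q]
  [IsManifold (𝓡 k) ∞ Q] [T2Space Q]

omit [T2Space N] in
theorem TwoForm.neg_swap (Ω : TwoForm n N) (x : N) (v w : TangentSpace (𝓡 n) x) :
    Ω.form x v w = -Ω.form x w v := by
  have h := Ω.alt x (v + w)
  simp only [map_add, _root_.add_apply, Ω.alt, zero_add, add_zero] at h
  linarith

omit [T2Space N] in
theorem TwoForm.apply_eq_zero_left (Ω : TwoForm n N) {x : N} {v : TangentSpace (𝓡 n) x}
    (hv : v ∈ Ω.ann x) (w : TangentSpace (𝓡 n) x) : Ω.form x v w = 0 := by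
  have h : Ω.form x v = 0 := hv
  rw [h, _root_.zero_apply]

omit [T2Space N] in
theorem TwoForm.apply_eq_zero_right (Ω : TwoForm n N) {x : N} {v : TangentSpace (𝓡 n) x}
    (hv : v ∈ Ω.ann x) (w : TangentSpace (𝓡 n) x) : Ω.form x w v = 0 := by
  rw [Ω.neg_swap, Ω.apply_eq_zero_left hv, neg_zero]

omit [T2Space N] in
theorem differentiableFieldAt_zero (x : N) :
    DifferentiableFieldAt (0 : Π x : N, TangentSpace (𝓡 n) x) x :=
  mdifferentiableAt_zeroSection ..

/-- Agreement of `V'` with `extend v` on a neighbourhood, not only at `p x`, is what the smoothness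
criterion for bilinear forms requires. -/
theorem exists_projectable_extension {p : N → Q} (hp : Manifold.IsSubmersion (𝓡 n) (𝓡 k) ∞ p)
    {x : N} (v : TangentSpace (𝓡 k) (p x)) :
    ∃ (V' : Π q : Q, TangentSpace (𝓡 k) q) (V : Π y : N, TangentSpace (𝓡 n) y),
      SmoothFieldOn univ V' ∧ SmoothFieldOn univ V ∧
      (∀ᶠ q in 𝓝 (p x), V' q = extend (EuclideanSpace ℝ (Fin k)) v q) ∧
      ∀ᶠ y in 𝓝 x, mfderiv (𝓡 n) (𝓡 k) p y (V y) = V' (p y) := by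
  obtain ⟨V', hV', hV'v⟩ := exists_smooth_extension v
  obtain ⟨F, _, _, ⟨c⟩⟩ := exists_submersionChart hp x
  obtain ⟨V, hV, hVV'⟩ := c.exists_lift hp.contMDiff isOpen_univ (mem_univ _) hV'
  exact ⟨V', V, hV', hV, hV'v, hVV'⟩

open VectorField in
/-- Contractions of a two-form with projectable fields are constant along the fibres, if the
vertical distribution is its annihilator, spanned by infinitesimal automorphisms. -/
theorem TwoForm.eventually_apply_eq_of_related {Ω : TwoForm n N}
    (haut : Ω.LocallySpannedByAutomorphisms Ω.ann) {p : N → Q}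
    (hp : Manifold.IsSubmersion (𝓡 n) (𝓡 k) ∞ p)
    (hann : ∀ x (v : TangentSpace (𝓡 n) x), v ∈ Ω.ann x ↔ mfderiv (𝓡 n) (𝓡 k) p x v = 0) {x : N}
    {V' W' : Π q : Q, TangentSpace (𝓡 k) q} {V W : Π y : N, TangentSpace (𝓡 n) y}
    (hV' : SmoothFieldOn univ V') (hW' : SmoothFieldOn univ W')
    (hV : SmoothFieldOn univ V) (hW : SmoothFieldOn univ W)
    (hVV' : ∀ᶠ y in 𝓝 x, mfderiv (𝓡 n) (𝓡 k) p y (V y) = V' (p y))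
    (hWW' : ∀ᶠ y in 𝓝 x, mfderiv (𝓡 n) (𝓡 k) p y (W y) = W' (p y)) :
    ∀ᶠ y in 𝓝 x, p y = p x → Ω.form y (V y) (W y) = Ω.form x (V x) (W x) := by
  obtain ⟨F, _, _, ⟨c⟩⟩ := exists_submersionChart hp x
  refine c.eventually_eq_of_mvfderiv_eq_zero (f := fun y ↦ Ω.form y (V y) (W y)) hp.contMDiff ?_
  obtain ⟨U, hU, hxU, m, X, hX, hspan⟩ := haut x
  filter_upwards [hU.mem_nhds hxU, hVV'.eventually_nhds, hWW'.eventually_nhds] with y hy hVy hWy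
  refine ⟨(contMDiffAt_bilin_apply Ω.smooth (b := fun y ↦ y) contMDiffAt_id
    (hV.contMDiffAt Filter.univ_mem) (hW.contMDiffAt Filter.univ_mem)).mdifferentiableAt (by simp),
    fun v hv ↦ ?_⟩
  rw [← hann, hspan y hy] at hv
  induction hv using Submodule.span_induction with
  | zero => simp
  | add v w _ _ hv hw => rw [map_add, hv, hw, add_zero]
  | smul a v _ hv => rw [map_smul, hv, smul_zero]
  | mem v hv =>
    obtain ⟨i, rfl⟩ := hv
    have hXd := (hX i).1.differentiableFieldAt (hU.mem_nhds hy)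
    -- `X i` is related to the zero field, so its bracket with a projectable field is related to
    -- zero, that is, lies in the annihilator.
    have hXv : ∀ᶠ z in 𝓝 y, mfderiv (𝓡 n) (𝓡 k) p z (X i z)
        = (0 : Π q : Q, TangentSpace (𝓡 k) q) (p z) := by
      filter_upwards [hU.mem_nhds hy] with z hz
      refine (hann z _).1 ?_
      rw [hspan z hz]
      exact Submodule.subset_span ⟨i, rfl⟩
    have hbr : ∀ (Z : Π y : N, TangentSpace (𝓡 n) y) (Z' : Π q : Q, TangentSpace (𝓡 k) q),
        SmoothFieldOn univ Z → SmoothFieldOn univ Z' →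
        (∀ᶠ z in 𝓝 y, mfderiv (𝓡 n) (𝓡 k) p z (Z z) = Z' (p z)) →
        mlieBracket (𝓡 n) (X i) Z y ∈ Ω.ann y := by
      intro Z Z' hZ hZ' hZZ'
      rw [hann, mfderiv_mlieBracket_of_related hp.contMDiff hXd
        (hZ.differentiableFieldAt Filter.univ_mem) (differentiableFieldAt_zero _)
        (hZ'.differentiableFieldAt Filter.univ_mem) hXv hZZ', mlieBracket_zero_left]
      rfl
    -- Both bracket terms of the Lie derivative vanish, which leaves the derivative of `Ω(V, W)`
    -- along `X i`.
    have hlie := (hX i).2 V W (hV.mono (subset_univ _)) (hW.mono (subset_univ _)) y hy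
    rw [lieDerivative, Ω.apply_eq_zero_left (hbr V V' hV hV' hVy),
      Ω.apply_eq_zero_right (hbr W W' hW hW' hWy), sub_zero, sub_zero] at hlie
    exact hlie

/-- Pull `Ω_x` back by a linear right inverse `R` of `dp`. The vectors `v` and `R (dp v)` differ by
an element of the annihilator, so the choice of `R` is harmless. -/
theorem TwoForm.exists_fibrewise_form {Ω : TwoForm n N} {p : N → Q}
    (hp : Manifold.IsSubmersion (𝓡 n) (𝓡 k) ∞ p)
    (hann : ∀ x (v : TangentSpace (𝓡 n) x), v ∈ Ω.ann x ↔ mfderiv (𝓡 n) (𝓡 k) p x v = 0) (x : N) :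
    ∃ B : TangentSpace (𝓡 k) (p x) →L[ℝ] TangentSpace (𝓡 k) (p x) →L[ℝ] ℝ,
      ∀ v w : TangentSpace (𝓡 n) x,
        Ω.form x v w = B (mfderiv (𝓡 n) (𝓡 k) p x v) (mfderiv (𝓡 n) (𝓡 k) p x w) := by
  have : FiniteDimensional ℝ (TangentSpace (𝓡 k) (p x)) :=
    inferInstanceAs (FiniteDimensional ℝ (EuclideanSpace ℝ (Fin k)))
  obtain ⟨R, hR⟩ := LinearMap.exists_rightInverse_of_surjective
    (mfderiv (𝓡 n) (𝓡 k) p x).toLinearMap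
    (LinearMap.range_eq_top.2 (mfderiv_surjective_of_isSubmersion hp x))
  have hR' : ∀ v, mfderiv (𝓡 n) (𝓡 k) p x (R v) = v := fun v ↦ congrArg (fun f ↦ f v) hR
  let Rc : EuclideanSpace ℝ (Fin k) →L[ℝ] EuclideanSpace ℝ (Fin n) :=
    LinearMap.toContinuousLinearMap (E := EuclideanSpace ℝ (Fin k)) R
  let B₀ : EuclideanSpace ℝ (Fin n) →L[ℝ] EuclideanSpace ℝ (Fin n) →L[ℝ] ℝ := Ω.form x
  refine ⟨B₀.bilinearComp Rc Rc, fun v w ↦ ?_⟩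
  have hsub : ∀ v, v - R (mfderiv (𝓡 n) (𝓡 k) p x v) ∈ Ω.ann x := by
    intro v
    rw [hann, map_sub, hR', sub_self]
  have h1 := Ω.apply_eq_zero_left (hsub v) w
  have h2 := Ω.apply_eq_zero_right (hsub w) (R (mfderiv (𝓡 n) (𝓡 k) p x v))
  rw [map_sub, _root_.sub_apply, sub_eq_zero] at h1
  rw [map_sub, sub_eq_zero] at h2
  exact h1.trans h2

/-- The fibrewise forms on the tangent spaces of the base agree along a connected fibre. -/
theorem TwoForm.fibrewise_form_eq {Ω : TwoForm n N}
    (haut : Ω.LocallySpannedByAutomorphisms Ω.ann) {p : N → Q}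
    (hp : Manifold.IsSubmersion (𝓡 n) (𝓡 k) ∞ p)
    (hann : ∀ x (v : TangentSpace (𝓡 n) x), v ∈ Ω.ann x ↔ mfderiv (𝓡 n) (𝓡 k) p x v = 0)
    (hfib : ∀ q : Q, IsConnected (p ⁻¹' {q}))
    {B : N → EuclideanSpace ℝ (Fin k) →L[ℝ] EuclideanSpace ℝ (Fin k) →L[ℝ] ℝ}
    (hB : ∀ x, ∀ v w : TangentSpace (𝓡 n) x,
      Ω.form x v w = B x (mfderiv (𝓡 n) (𝓡 k) p x v) (mfderiv (𝓡 n) (𝓡 k) p x w))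
    {x y : N} (hxy : p x = p y) : B x = B y := by
  refine ContinuousLinearMap.ext fun v ↦ ContinuousLinearMap.ext fun w ↦ ?_
  have hlocal : ∀ z : N, ∀ᶠ y in 𝓝 z, p y = p z → B y v w = B z v w := by
    intro z
    obtain ⟨V', V, hV', hV, hV'v, hVV'⟩ := exists_projectable_extension hp (x := z) v
    obtain ⟨W', W, hW', hW, hW'w, hWW'⟩ := exists_projectable_extension hp (x := z) w
    have hv : V' (p z) = v := hV'v.self_of_nhds.trans (extend_apply_self _ _)
    have hw : W' (p z) = w := hW'w.self_of_nhds.trans (extend_apply_self _ _)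
    have hval : ∀ y, mfderiv (𝓡 n) (𝓡 k) p y (V y) = V' (p y) →
        mfderiv (𝓡 n) (𝓡 k) p y (W y) = W' (p y) → p y = p z →
        Ω.form y (V y) (W y) = B y v w := by
      intro y hVy hWy hyz
      have hv' : (V' (p y) : EuclideanSpace ℝ (Fin k)) = v :=
        (congrArg (fun q ↦ (V' q : EuclideanSpace ℝ (Fin k))) hyz).trans hv
      have hw' : (W' (p y) : EuclideanSpace ℝ (Fin k)) = w :=
        (congrArg (fun q ↦ (W' q : EuclideanSpace ℝ (Fin k))) hyz).trans hw
      rw [hB, hVy, hWy]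
      exact congrArg₂ (fun a b ↦ B y a b) hv' hw'
    filter_upwards [Ω.eventually_apply_eq_of_related haut hp hann hV' hW' hV hW hVV' hWW', hVV', hWW']
      with y hy hVy hWy hyz
    rw [← hval y hVy hWy hyz, ← hval z hVV'.self_of_nhds hWW'.self_of_nhds rfl, hy hyz]
  have : PreconnectedSpace (p ⁻¹' {p y}) :=
    Subtype.preconnectedSpace (hfib (p y)).isPreconnected
  have hloc : IsLocallyConstant fun z : p ⁻¹' {p y} ↦ B z v w := by
    rw [IsLocallyConstant.iff_eventually_eq]
    intro z
    have := continuous_subtype_val.continuousAt.eventually (hlocal (z : N))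
    filter_upwards [this] with z' hz'
    exact hz' ((show p z' = p y from z'.2).trans (show p z = p y from z.2).symm)
  exact hloc.apply_eq_of_preconnectedSpace ⟨x, hxy⟩ ⟨y, rfl⟩

omit [T2Space N] [T2Space Q] in
theorem exists_local_section {p : N → Q} (hp : Manifold.IsSubmersion (𝓡 n) (𝓡 k) ∞ p) (x : N) :
    ∃ s : Q → N, ContMDiffAt (𝓡 k) (𝓡 n) ∞ s (p x) ∧ s (p x) = x ∧
      ∀ᶠ q in 𝓝 (p x), p (s q) = q := by
  obtain ⟨F, _, _, ⟨c⟩⟩ := exists_submersionChart hp x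
  exact c.exists_section

theorem TwoForm.exists_isPullback {Ω : TwoForm n N}
    (haut : Ω.LocallySpannedByAutomorphisms Ω.ann) {p : N → Q}
    (hp : Manifold.IsSubmersion (𝓡 n) (𝓡 k) ∞ p)
    (hann : ∀ x (v : TangentSpace (𝓡 n) x), v ∈ Ω.ann x ↔ mfderiv (𝓡 n) (𝓡 k) p x v = 0)
    (hfib : ∀ q : Q, IsConnected (p ⁻¹' {q})) :
    ∃ Ψ : TwoForm k Q, IsPullback p Ω Ψ := by
  choose B₀ hB₀ using fun x ↦ Ω.exists_fibrewise_form hp hann x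
  -- Every tangent space of `Q` is the model space, so forms at different points of a fibre can be
  -- compared as elements of one space.
  let B : N → EuclideanSpace ℝ (Fin k) →L[ℝ] EuclideanSpace ℝ (Fin k) →L[ℝ] ℝ := B₀
  choose σ hσ using fun q ↦ (hfib q).nonempty
  have hσ' : ∀ q, p (σ q) = q := hσ
  -- `σ` is an arbitrary choice of points; `ψ` is independent of it since `B` is constant on fibres.
  let ψ : Π q : Q, TangentSpace (𝓡 k) q →L[ℝ] TangentSpace (𝓡 k) q →L[ℝ] ℝ := fun q ↦ B (σ q)
  have hψ : ∀ x, ∀ v w : TangentSpace (𝓡 n) x, Ω.form x v w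
      = ψ (p x) (mfderiv (𝓡 n) (𝓡 k) p x v) (mfderiv (𝓡 n) (𝓡 k) p x w) := by
    intro x v w
    have h1 : B x = B (σ (p x)) := Ω.fibrewise_form_eq haut hp hann hfib hB₀ (hσ' (p x)).symm
    refine (hB₀ x v w).trans ?_
    exact congrArg (fun b : EuclideanSpace ℝ (Fin k) →L[ℝ] EuclideanSpace ℝ (Fin k) →L[ℝ] ℝ ↦
      b (mfderiv (𝓡 n) (𝓡 k) p x v) (mfderiv (𝓡 n) (𝓡 k) p x w)) h1
  refine ⟨⟨ψ, fun q v ↦ ?_, fun q ↦ ?_⟩, hψ⟩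
  · obtain ⟨x, rfl⟩ : ∃ x, p x = q := ⟨σ q, hσ' q⟩
    obtain ⟨u, rfl⟩ := mfderiv_surjective_of_isSubmersion hp x v
    rw [← hψ, Ω.alt]
  · obtain ⟨x, rfl⟩ : ∃ x, p x = q := ⟨σ q, hσ' q⟩
    refine contMDiffAt_bilin_section fun v w ↦ ?_
    obtain ⟨V', V, hV', hV, hV'v, hVV'⟩ := exists_projectable_extension hp v
    obtain ⟨W', W, hW', hW, hW'w, hWW'⟩ := exists_projectable_extension hp w
    obtain ⟨s, hs, hsx, hps⟩ := exists_local_section hp x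
    have hf : ContMDiffAt (𝓡 n) 𝓘(ℝ, ℝ) ∞ (fun y ↦ Ω.form y (V y) (W y)) x :=
      contMDiffAt_bilin_apply Ω.smooth (b := fun y ↦ y) contMDiffAt_id
        (hV.contMDiffAt Filter.univ_mem) (hW.contMDiffAt Filter.univ_mem)
    -- Near `p x`, the matrix entries of `ψ` are `Ω(V, W)` composed with a smooth local section `s`.
    refine (hf.comp_of_eq hs hsx).congr_of_eventuallyEq ?_
    have hsc : Filter.Tendsto s (𝓝 (p x)) (𝓝 x) := by
      have := hs.continuousAt.tendsto
      rwa [hsx] at this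
    filter_upwards [hps, hV'v, hW'w, hsc.eventually hVV', hsc.eventually hWW'] with q hq hv hw hVq hWq
    rw [← hv, ← hw, Function.comp_apply, hψ, hVq, hWq, hq]

omit [T2Space N] [T2Space Q] in
theorem IsPullback.nondegenerate {Ω : TwoForm n N} {p : N → Q}
    (hp : Manifold.IsSubmersion (𝓡 n) (𝓡 k) ∞ p)
    (hann : ∀ x (v : TangentSpace (𝓡 n) x), v ∈ Ω.ann x ↔ mfderiv (𝓡 n) (𝓡 k) p x v = 0)
    (hsurj : Function.Surjective p) {Ψ : TwoForm k Q} (h : IsPullback p Ω Ψ) :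
    Ψ.Nondegenerate := by
  intro q v hv
  obtain ⟨x, rfl⟩ := hsurj q
  obtain ⟨u, rfl⟩ := mfderiv_surjective_of_isSubmersion hp x v
  rw [← hann]
  exact ContinuousLinearMap.ext fun w ↦ (h x u w).trans (hv _)

omit [T2Space N] [T2Space Q] in
theorem IsPullback.unique {Ω : TwoForm n N} {p : N → Q}
    (hp : Manifold.IsSubmersion (𝓡 n) (𝓡 k) ∞ p)
    (hsurj : Function.Surjective p) {Ψ Ψ' : TwoForm k Q} (h : IsPullback p Ω Ψ)
    (h' : IsPullback p Ω Ψ') : Ψ' = Ψ := by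
  refine TwoForm.ext (funext fun q ↦ ?_)
  obtain ⟨x, rfl⟩ := hsurj q
  refine ContinuousLinearMap.ext fun v ↦ ContinuousLinearMap.ext fun w ↦ ?_
  obtain ⟨v, rfl⟩ := mfderiv_surjective_of_isSubmersion hp x v
  obtain ⟨w, rfl⟩ := mfderiv_surjective_of_isSubmersion hp x w
  exact (h' x v w).symm.trans (h x v w)

end Projection

end

end Presymplectic

namespace Presymplectic

noncomputable section

open Bundle FiberBundle VectorField

/-! ### The Koszul formula and smoothness of covariant derivatives -/

section LeviCivita

variable {n : ℕ} {M : Type*} [TopologicalSpace M] [ChartedSpace (EuclideanSpace ℝ (Fin n)) M]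
  [IsManifold (𝓡 n) ∞ M]

/-- The Koszul formula. -/
theorem PseudoMetric.IsLeviCivita.koszul {g : PseudoMetric n M}
    {cov : CovariantDerivative (𝓡 n) (EuclideanSpace ℝ (Fin n))
      (TangentSpace (𝓡 n) : M → Type _)} (h : g.IsLeviCivita cov)
    {X Y Z : Π x : M, TangentSpace (𝓡 n) x} {x : M} (hX : DifferentiableFieldAt X x)
    (hY : DifferentiableFieldAt Y x) (hZ : DifferentiableFieldAt Z x) :
    2 * g.form x (cov Y x (X x)) (Z x)
      = mvfderiv (𝓡 n) (fun y ↦ g.form y (Y y) (Z y)) x (X x)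
        + mvfderiv (𝓡 n) (fun y ↦ g.form y (X y) (Z y)) x (Y x)
        - mvfderiv (𝓡 n) (fun y ↦ g.form y (X y) (Y y)) x (Z x)
        + g.form x (mlieBracket (𝓡 n) X Y x) (Z x)
        - g.form x (mlieBracket (𝓡 n) X Z x) (Y x)
        - g.form x (mlieBracket (𝓡 n) Y Z x) (X x) := by
  have : IsManifold (𝓡 n) 2 M := IsManifold.of_le (n := ∞) (by norm_cast)
  have ht : ∀ {A B : Π x : M, TangentSpace (𝓡 n) x}, DifferentiableFieldAt A x →
      DifferentiableFieldAt B x →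
      cov B x (A x) - cov A x (B x) = mlieBracket (𝓡 n) A B x := fun hA hB ↦
    cov.torsion_eq_zero_iff.1 h.torsion_free hA hB
  rw [h.metric Y Z x (X x) hY hZ, h.metric X Z x (Y x) hX hZ, h.metric X Y x (Z x) hX hY,
    ← ht hX hY, ← ht hX hZ, ← ht hY hZ]
  simp only [map_sub, _root_.sub_apply]
  rw [g.symm x (Y x) (cov Z x (X x)), g.symm x (X x) (cov Z x (Y x)),
    g.symm x (X x) (cov Y x (Z x))]
  ring

variable [T2Space M]

/-- A smooth connection maps smooth fields on an open set to smooth fields. -/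
theorem smoothFieldOn_cov {cov : CovariantDerivative (𝓡 n) (EuclideanSpace ℝ (Fin n))
      (TangentSpace (𝓡 n) : M → Type _)}
    (h : CovariantDerivative.ContMDiffCovariantDerivative cov ∞) {U : Set M} (hU : IsOpen U)
    {X Y : Π x : M, TangentSpace (𝓡 n) x} (hX : SmoothFieldOn U X) (hY : SmoothFieldOn U Y) :
    SmoothFieldOn U (fun x ↦ cov Y x (X x)) := by
  intro x hx
  refine ContMDiffAt.contMDiffWithinAt ?_
  -- Smoothness of the connection is applied to a global field with the germ of `Y` at `x`; the
  -- covariant derivative depends only on germs.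
  obtain ⟨Y₁, hY₁, hYY₁⟩ := exists_smooth_eventuallyEq hU hY hx
  have h1 := (h.contMDiff.contMDiff (σ := Y₁) hY₁).contMDiffAt (x := x) Filter.univ_mem
  refine (h1.clm_bundle_apply (v := X) (hX.contMDiffAt (hU.mem_nhds hx))).congr_of_eventuallyEq ?_
  filter_upwards [hYY₁.eventually_nhds, hU.mem_nhds hx] with y hy hyU
  have h2 : cov Y₁ y = cov Y y :=
    cov.isCovariantDerivativeOnUniv.congr_of_eventuallyEq
      (hY₁.differentiableFieldAt Filter.univ_mem)
      (hY.differentiableFieldAt (hU.mem_nhds hyU)) Filter.univ_mem hy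
  rw [h2]

end LeviCivita

/-! ### Projection of the Levi-Civita connection -/

section Projection

variable {n k : ℕ}
  {N : Type*} [TopologicalSpace N] [ChartedSpace (EuclideanSpace ℝ (Fin n)) N]
  [IsManifold (𝓡 n) ∞ N]
  {Q : Type*} [TopologicalSpace Q] [ChartedSpace (EuclideanSpace ℝ (Fin k)) Q]
  [IsManifold (𝓡 k) ∞ Q]
  {p : N → Q} {K : Π x : N, Submodule ℝ (TangentSpace (𝓡 n) x)}
  {g : PseudoMetric n N} {l : PseudoMetric k Q}

theorem PseudoMetric.prPerp_mem (hg : g.NondegenerateOn K) (x : N) (v : TangentSpace (𝓡 n) x) :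
    g.prPerp K hg x v ∈ g.perp K x :=
  Submodule.projection_apply_mem ..

theorem PseudoMetric.sub_prPerp_mem (hg : g.NondegenerateOn K) (x : N)
    (v : TangentSpace (𝓡 n) x) : v - g.prPerp K hg x v ∈ K x :=
  Submodule.sub_projection_mem ..

theorem PseudoMetric.form_prPerp (hg : g.NondegenerateOn K) {x : N} (v : TangentSpace (𝓡 n) x)
    {z : TangentSpace (𝓡 n) x} (hz : z ∈ g.perp K x) :
    g.form x (g.prPerp K hg x v) z = g.form x v z := by
  have h := (g.mem_perp K x z).1 hz _ (g.sub_prPerp_mem hg x v)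
  rw [map_sub, _root_.sub_apply, sub_eq_zero] at h
  exact h.symm

section

variable (hK : ∀ x (v : TangentSpace (𝓡 n) x), v ∈ K x ↔ mfderiv (𝓡 n) (𝓡 k) p x v = 0)
include hK

theorem mfderiv_prPerp (hg : g.NondegenerateOn K) (x : N) (v : TangentSpace (𝓡 n) x) :
    mfderiv (𝓡 n) (𝓡 k) p x (g.prPerp K hg x v) = mfderiv (𝓡 n) (𝓡 k) p x v := by
  have h := (hK x _).1 (g.sub_prPerp_mem hg x v)
  rw [map_sub, sub_eq_zero] at h
  exact h.symm

/-- Only one argument has to be horizontal: the `K`-part of `v` is invisible both to `g(·, z)` and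
to `dp`. This is what handles brackets, which need not be horizontal. -/
theorem RestrictionIsPullback.form_eq (hgl : RestrictionIsPullback p (g.perp K) g l)
    (hg : g.NondegenerateOn K) {x : N} (v : TangentSpace (𝓡 n) x) {z : TangentSpace (𝓡 n) x}
    (hz : z ∈ g.perp K x) :
    g.form x v z
      = l.form (p x) (mfderiv (𝓡 n) (𝓡 k) p x v) (mfderiv (𝓡 n) (𝓡 k) p x z) := by
  rw [← g.form_prPerp hg v hz, hgl x _ (g.prPerp_mem hg x v) z hz, mfderiv_prPerp hK hg]

/-- The orthogonal projection of a smooth field is smooth. -/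
theorem contMDiffAt_prPerp (hp : ContMDiff (𝓡 n) (𝓡 k) ∞ p)
    (hgl : RestrictionIsPullback p (g.perp K) g l)
    (hg : g.NondegenerateOn K) {Z : Π x : N, TangentSpace (𝓡 n) x} {x : N}
    (hZ : ContMDiffAt (𝓡 n) (𝓡 n).tangent ∞ (fun y ↦ (⟨y, Z y⟩ : TangentBundle (𝓡 n) N)) x) :
    ContMDiffAt (𝓡 n) (𝓡 n).tangent ∞
      (fun y ↦ (⟨y, g.prPerp K hg y (Z y)⟩ : TangentBundle (𝓡 n) N)) x := by
  refine g.contMDiffAt_field fun w ↦ ?_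
  have hdp : ContMDiff (𝓡 n).tangent (𝓡 k).tangent ∞ (tangentMap (𝓡 n) (𝓡 k) p) :=
    hp.contMDiff_tangentMap (by simp)
  have hw : ContMDiffAt (𝓡 n) (𝓡 n).tangent ∞
      (fun y ↦ (⟨y, extend (EuclideanSpace ℝ (Fin n)) w y⟩ : TangentBundle (𝓡 n) N)) x :=
    contMDiffAt_extend ..
  -- The contraction `g(pr Z, w)` equals `l(dp w, dp Z)`, which is smooth without any knowledge of
  -- the projector; `g.contMDiffAt_field` then recovers the field.
  refine (contMDiffAt_bilin_apply l.smooth (hp x) (hdp.contMDiffAt.comp x hw)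
    (hdp.contMDiffAt.comp x hZ)).congr_of_eventuallyEq (Filter.Eventually.of_forall fun y ↦ ?_)
  refine (g.symm y _ _).trans ((hgl.form_eq hK hg _ (g.prPerp_mem hg y (Z y))).trans ?_)
  rw [mfderiv_prPerp hK hg]

end

variable [T2Space N] [T2Space Q]

omit [IsManifold (𝓡 k) ∞ Q] in
theorem mvfderiv_form_of_related {x : N} (hp : ContMDiff (𝓡 n) (𝓡 k) ∞ p) {f : N → ℝ} {f' : Q → ℝ}
    (hf' : MDifferentiableAt (𝓡 k) 𝓘(ℝ, ℝ) f' (p x)) (hff' : ∀ᶠ y in 𝓝 x, f y = f' (p y))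
    {v : TangentSpace (𝓡 n) x} {v' : TangentSpace (𝓡 k) (p x)}
    (hv : mfderiv (𝓡 n) (𝓡 k) p x v = v') :
    mvfderiv (𝓡 n) f x v = mvfderiv (𝓡 k) f' (p x) v' := by
  rw [← hv, mvfderiv_congr hff', mvfderiv_comp_apply hf' ((hp x).mdifferentiableAt (by simp))]

/-- A local section through `x ∈ U` maps a neighbourhood of `p x` into `U`. -/
theorem isOpen_image_of_isSubmersion (hp : Manifold.IsSubmersion (𝓡 n) (𝓡 k) ∞ p) {U : Set N}
    (hU : IsOpen U) : IsOpen (p '' U) := by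
  refine isOpen_iff_mem_nhds.2 ?_
  rintro _ ⟨x, hx, rfl⟩
  obtain ⟨s, hs, hsx, hps⟩ := exists_local_section hp x
  have h := hs.continuousAt.preimage_mem_nhds (hsx.symm ▸ hU.mem_nhds hx)
  filter_upwards [h, hps] with q hq hpq using ⟨s q, hq, hpq⟩

/-- Under a Riemannian submersion, the Levi-Civita connection on horizontal projectable fields
projects to the Levi-Civita connection of the base. -/
theorem mfderiv_cov_eq (hK : ∀ x (v : TangentSpace (𝓡 n) x),
      v ∈ K x ↔ mfderiv (𝓡 n) (𝓡 k) p x v = 0)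
    (hp : Manifold.IsSubmersion (𝓡 n) (𝓡 k) ∞ p)
    (hgl : RestrictionIsPullback p (g.perp K) g l) (hg : g.NondegenerateOn K)
    {cov : CovariantDerivative (𝓡 n) (EuclideanSpace ℝ (Fin n))
      (TangentSpace (𝓡 n) : N → Type _)}
    {cov' : CovariantDerivative (𝓡 k) (EuclideanSpace ℝ (Fin k))
      (TangentSpace (𝓡 k) : Q → Type _)}
    (hcov : g.IsLeviCivita cov) (hcov' : l.IsLeviCivita cov') {U : Set N} (hU : IsOpen U)
    {X Y : Π x : N, TangentSpace (𝓡 n) x} {X' Y' : Π q : Q, TangentSpace (𝓡 k) q}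
    (hXK : ∀ x ∈ U, X x ∈ g.perp K x) (hYK : ∀ x ∈ U, Y x ∈ g.perp K x)
    (hX : ProjectsToOn p U X X') (hY : ProjectsToOn p U Y Y') {x : N} (hx : x ∈ U) :
    mfderiv (𝓡 n) (𝓡 k) p x (cov Y x (X x)) = cov' Y' (p x) (X' (p x)) := by
  have hUx := hU.mem_nhds hx
  have hU' := (isOpen_image_of_isSubmersion hp hU).mem_nhds (mem_image_of_mem p hx)
  refine sub_eq_zero.1 (l.nondegenerate (p x) _ fun w' ↦ ?_)
  rw [map_sub, _root_.sub_apply, sub_eq_zero]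
  obtain ⟨Z', V, hZ', hV, hZ'w, hVZ'⟩ := exists_projectable_extension hp w'
  -- Removing the vertical part of the lift makes it horizontal and leaves its projection `Z'`, with
  -- value `w'` at `p x`, unchanged.
  set Z : Π y : N, TangentSpace (𝓡 n) y := fun y ↦ g.prPerp K hg y (V y) with hZdef
  have hZK : ∀ y, Z y ∈ g.perp K y := fun y ↦ g.prPerp_mem hg y _
  have hZ : DifferentiableFieldAt Z x :=
    (contMDiffAt_prPerp hK hp.contMDiff hgl hg (hV.contMDiffAt Filter.univ_mem)).mdifferentiableAt
      (by simp)
  have hZZ' : ∀ᶠ y in 𝓝 x, mfderiv (𝓡 n) (𝓡 k) p y (Z y) = Z' (p y) := by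
    filter_upwards [hVZ'] with y hy
    exact (mfderiv_prPerp hK hg y _).trans hy
  have hXX' : ∀ᶠ y in 𝓝 x, mfderiv (𝓡 n) (𝓡 k) p y (X y) = X' (p y) := by
    filter_upwards [hUx] with y hy using hX.2.2 y hy
  have hYY' : ∀ᶠ y in 𝓝 x, mfderiv (𝓡 n) (𝓡 k) p y (Y y) = Y' (p y) := by
    filter_upwards [hUx] with y hy using hY.2.2 y hy
  have hXd := hX.1.differentiableFieldAt hUx
  have hYd := hY.1.differentiableFieldAt hUx
  have hXc' := hX.2.1.contMDiffAt hU'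
  have hYc' := hY.2.1.contMDiffAt hU'
  have hZc' := hZ'.contMDiffAt (x := p x) Filter.univ_mem
  have hXd' := hX.2.1.differentiableFieldAt hU'
  have hYd' := hY.2.1.differentiableFieldAt hU'
  have hZd' := hZ'.differentiableFieldAt (x := p x) Filter.univ_mem
  have hform : ∀ {A B : Π y : N, TangentSpace (𝓡 n) y} {A' B' : Π q : Q, TangentSpace (𝓡 k) q},
      (∀ᶠ y in 𝓝 x, mfderiv (𝓡 n) (𝓡 k) p y (A y) = A' (p y)) →
      (∀ᶠ y in 𝓝 x, mfderiv (𝓡 n) (𝓡 k) p y (B y) = B' (p y)) →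
      (∀ᶠ y in 𝓝 x, B y ∈ g.perp K y) →
      ∀ᶠ y in 𝓝 x, g.form y (A y) (B y) = (fun q ↦ l.form q (A' q) (B' q)) (p y) := by
    intro A B A' B' hA hB hBK
    filter_upwards [hA, hB, hBK] with y hAy hBy hBKy
    rw [hgl.form_eq hK hg _ hBKy, hAy, hBy]
  have hbr : ∀ {A B C : Π y : N, TangentSpace (𝓡 n) y} {A' B' C' : Π q : Q, TangentSpace (𝓡 k) q},
      DifferentiableFieldAt A x → DifferentiableFieldAt B x →
      DifferentiableFieldAt A' (p x) → DifferentiableFieldAt B' (p x) →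
      (∀ᶠ y in 𝓝 x, mfderiv (𝓡 n) (𝓡 k) p y (A y) = A' (p y)) →
      (∀ᶠ y in 𝓝 x, mfderiv (𝓡 n) (𝓡 k) p y (B y) = B' (p y)) →
      (∀ᶠ y in 𝓝 x, mfderiv (𝓡 n) (𝓡 k) p y (C y) = C' (p y)) → C x ∈ g.perp K x →
      g.form x (mlieBracket (𝓡 n) A B x) (C x)
        = l.form (p x) (mlieBracket (𝓡 k) A' B' (p x)) (C' (p x)) := by
    intro A B C A' B' C' hA hB hA' hB' hAA' hBB' hCC' hC
    rw [hgl.form_eq hK hg _ hC, hCC'.self_of_nhds,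
      mfderiv_mlieBracket_of_related hp.contMDiff hA hB hA' hB' hAA' hBB']
  have hder : ∀ {A B : Π q : Q, TangentSpace (𝓡 k) q},
      ContMDiffAt (𝓡 k) (𝓡 k).tangent ∞ (fun q ↦ (⟨q, A q⟩ : TangentBundle (𝓡 k) Q)) (p x) →
      ContMDiffAt (𝓡 k) (𝓡 k).tangent ∞ (fun q ↦ (⟨q, B q⟩ : TangentBundle (𝓡 k) Q)) (p x) →
      MDifferentiableAt (𝓡 k) 𝓘(ℝ, ℝ) (fun q ↦ l.form q (A q) (B q)) (p x) := fun hA hB ↦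
    (contMDiffAt_bilin_apply (b := id) l.smooth contMDiffAt_id hA hB).mdifferentiableAt (by simp)
  have hYK' : ∀ᶠ y in 𝓝 x, Y y ∈ g.perp K y := by filter_upwards [hUx] with y hy using hYK y hy
  -- The six Koszul terms on `N` are rewritten one by one into those on `Q`.
  have hN := hcov.koszul hXd hYd hZ
  have hQ := hcov'.koszul hXd' hYd' hZd'
  rw [mvfderiv_form_of_related hp.contMDiff (hder hYc' hZc')
      (hform hYY' hZZ' (Filter.Eventually.of_forall hZK)) hXX'.self_of_nhds,
    mvfderiv_form_of_related hp.contMDiff (hder hXc' hZc')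
      (hform hXX' hZZ' (Filter.Eventually.of_forall hZK)) hYY'.self_of_nhds,
    mvfderiv_form_of_related hp.contMDiff (hder hXc' hYc')
      (hform hXX' hYY' hYK') hZZ'.self_of_nhds,
    hbr hXd hYd hXd' hYd' hXX' hYY' hZZ' (hZK x),
    hbr hXd hZ hXd' hZd' hXX' hZZ' hYY' (hYK x hx),
    hbr hYd hZ hYd' hZd' hYY' hZZ' hXX' (hXK x hx), ← hQ,
    hgl.form_eq hK hg _ (hZK x), hZZ'.self_of_nhds] at hN
  have hw : Z' (p x) = w' := hZ'w.self_of_nhds.trans (extend_apply_self ..)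
  rw [hw] at hN
  exact mul_left_cancel₀ two_ne_zero hN

theorem connectionProjects (hK : ∀ x (v : TangentSpace (𝓡 n) x),
      v ∈ K x ↔ mfderiv (𝓡 n) (𝓡 k) p x v = 0)
    (hp : Manifold.IsSubmersion (𝓡 n) (𝓡 k) ∞ p)
    (hgl : RestrictionIsPullback p (g.perp K) g l) (hg : g.NondegenerateOn K)
    {cov : CovariantDerivative (𝓡 n) (EuclideanSpace ℝ (Fin n))
      (TangentSpace (𝓡 n) : N → Type _)}
    {cov' : CovariantDerivative (𝓡 k) (EuclideanSpace ℝ (Fin k))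
      (TangentSpace (𝓡 k) : Q → Type _)}
    (hcov : g.IsLeviCivita cov) (hcov' : l.IsLeviCivita cov') :
    ConnectionProjects p g K hg cov cov' := by
  intro U hU X Y X' Y' hXK hYK hX hY
  refine ⟨fun x hx ↦ ?_, smoothFieldOn_cov hcov'.smooth (isOpen_image_of_isSubmersion hp hU)
    hX.2.1 hY.2.1, fun x hx ↦ ?_⟩
  · exact (contMDiffAt_prPerp hK hp.contMDiff hgl hg
      ((smoothFieldOn_cov hcov.smooth hU hX.1 hY.1).contMDiffAt
        (hU.mem_nhds hx))).contMDiffWithinAt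
  · exact (mfderiv_prPerp hK hg x _).trans
      (mfderiv_cov_eq hK hp hgl hg hcov hcov' hU hXK hYK hX hY hx)

end Projection

end

end Presymplectic

theorem proposition5p1 {n r : ℕ}
    {N : Type*} [TopologicalSpace N] [T2Space N]
    [ChartedSpace (EuclideanSpace ℝ (Fin n)) N] [IsManifold (𝓡 n) ∞ N]
    {Q : Type*} [TopologicalSpace Q] [T2Space Q]
    [ChartedSpace (EuclideanSpace ℝ (Fin (2 * r))) Q] [IsManifold (𝓡 (2 * r)) ∞ Q]
    (Ω : Presymplectic.TwoForm n N) (hrank : Ω.HasConstantRank (2 * r))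
    (hfol : Presymplectic.IsTangentToFoliation (2 * r) Ω.ann)
    (haut : Ω.LocallySpannedByAutomorphisms Ω.ann)
    (p : N → Q) (hsub : Manifold.IsSubmersion (𝓡 n) (𝓡 (2 * r)) ∞ p)
    (hfib : ∀ q : Q, IsConnected (p ⁻¹' {q}))
    (hleaf : ∀ x : N, ∀ y ∈ Presymplectic.leaf Ω.ann x, p y = p x) :
    (∃ Ψ : Presymplectic.TwoForm (2 * r) Q,
      Ψ.Nondegenerate ∧ Presymplectic.IsPullback p Ω Ψ ∧
        ∀ Ψ' : Presymplectic.TwoForm (2 * r) Q, Presymplectic.IsPullback p Ω Ψ' → Ψ' = Ψ) ∧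
    ∀ (g : Presymplectic.PseudoMetric n N) (hgK : g.NondegenerateOn Ω.ann)
      (l : Presymplectic.PseudoMetric (2 * r) Q),
      Presymplectic.RestrictionIsPullback p (g.perp Ω.ann) g l →
      ∀ (covg : CovariantDerivative (𝓡 n) (EuclideanSpace ℝ (Fin n))
            (TangentSpace (𝓡 n) : N → Type _))
        (covl : CovariantDerivative (𝓡 (2 * r)) (EuclideanSpace ℝ (Fin (2 * r)))
            (TangentSpace (𝓡 (2 * r)) : Q → Type _)),
        g.IsLeviCivita covg → l.IsLeviCivita covl →
        Presymplectic.ConnectionProjects p g Ω.ann hgK covg covl := by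
  have hann := Presymplectic.TwoForm.mem_ann_iff_mfderiv_eq_zero hrank hfol hsub hleaf
  -- Connected sets are non-empty by definition, which gives surjectivity.
  have hsurj : Function.Surjective p := fun q ↦ (hfib q).nonempty
  refine ⟨?_, fun g hgK l hgl covg covl hcovg hcovl ↦
    Presymplectic.connectionProjects hann hsub hgl hgK hcovg hcovl⟩
  obtain ⟨Ψ, hΨ⟩ := Presymplectic.TwoForm.exists_isPullback haut hsub hann hfib
  exact ⟨Ψ, hΨ.nondegenerate hsub hann hsurj, hΨ, fun Ψ' hΨ' ↦ hΨ.unique hsub hsurj hΨ'⟩
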